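/- All logarithms are to base $2$, and $H$ and $I$ are measured in bits. Let $\mathcal X,\mathcal Y$ be Polish spaces, $p_X$ a probability measure on $\mathcal X$ and $p_{Y|X}$ a Markov kernel from $\mathcal X$ to $\mathcal Y$ with $I(X;Y)<\infty$. Let $n\ge 1$ and $\Delta>0$, let $X^n$ be i.i.d. from $p_X$, and let $Y^n$ be the output of the memoryless channel $p_{Y^n|X^n}=\prod_i p_{Y|X}$ with input $X^n$. For $t\in\mathbb R$ put $Q_\Delta(t)=\Delta\lfloor t/\Delta\rfloor$, and define $$\Gamma=Q_\Delta\Big(\log\tfrac{dp_{Y^n|X^n}}{dp_{Y^n}}(Y^n|X^n)\Big),\quad \overline\Gamma_1=Q_\Delta\Big(\log\tfrac1{p_{\Gamma|X^n}(\Gamma|X^n)}\Big),\quad \overline\Gamma_2=Q_\Delta\Big(\log\tfrac1{p_\Gamma(\Gamma)}\Big),$$ $$\overline{\overline\Gamma}=Q_\Delta\Big(\log\tfrac1{p_{\overline\Gamma_1,\overline\Gamma_2|X^n}(\overline\Gamma_1,\overline\Gamma_2|X^n)}\Big).$$ The channel $p_{Y^n|X^n}$ is called singular if $\frac{dp_{Y^n|X^n}}{dp_{Y^n}}(Y^n|X^n)$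 is almost surely equal to a measurable function of $Y^n$. A code consists of common randomness $U$ independent of $X^n$, an encoder $f$ with $f(x^n,u)\in\{0,1\}^*$ such that the range of $f(\cdot,u)$ is prefix-free for every $u$, and a decoder $g$ with $g(w,u)\in\mathcal Y^n$. It simulates the channel if $(X^n,g(f(X^n,U),U))$ has the law of $(X^n,Y^n)$, and its rate is $\frac1n\mathbb E[\text{length of }f(X^n,U)]$. Rejection sampling with target $P^*$, proposal $Q$ and ceiling $M$ selects the first index $i$ with $V_i\le\frac1M\frac{dP^*}{dQ}(Z_i)$, where $Z_1,Z_2,\dots$ is a codebook of i.i.d. samples from $Q$ and $V_1,V_2,\dots$ are i.i.d. uniform on $[0,1]$. All the random choices below are part of $U$, and every symbol is described with an optimal (least expected length) prefix-free code for the stated law. The two-stage scheme is the following code. On input $x^n$: 1. The encoder draws $(\overline\gamma_1,\overline\gamma_2,\overline{\overline\gamma})$ from the conditional law of $(\overline\Gamma_1,\overline\Gamma_2,\overline{\overline\Gamma})$ given $X^n=x^n$, and sends it with an optimal prefix-free code for the law of $(\overline\Gamma_1,\overline\Gamma_2,\overline{\overline\Gamma})$. Put $\overline\gamma=\overline\gamma_2-\overline\gamma_1$.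 2. It applies rejection sampling with target $p_{\Gamma|X^n,\overline\Gamma_1,\overline\Gamma_2}(\cdot|x^n,\overline\gamma_1,\overline\gamma_2)$, proposal $p_\Gamma$ and ceiling $\tau_{\mathrm{aux}}=2^{\overline\gamma+3\Delta+\overline{\overline\gamma}}$, and sends the selected index $K$ with an optimal prefix-free code for the geometric law with success probability $1/\tau_{\mathrm{aux}}$. Let $\gamma$ be the selected codebook entry. 3. It applies rejection sampling with target $p_{Y^n|X^n,\Gamma}(\cdot|x^n,\gamma)$, proposal $W$ and ceiling $\tau$, and sends the selected index $J$ with an optimal prefix-free code for the geometric law with success probability $1/\tau$. Here $W=p_{Y^n|\Gamma}(\cdot|\gamma)$ and $\tau=2^{\gamma-\overline\gamma+2\Delta}$ if the channel is singular, and $W=p_{Y^n}$ and $\tau=2^{\gamma+\overline\gamma_1+2\Delta}$ otherwise. The decoder outputs the selected codebook entry. Then, for every choice of the optimal prefix-free codes, this scheme simulates the channel $p_{Y^n|X^n}$, and its rate $R$ satisfies $$R\le I(X;Y)+\frac{\mathcal E}{n}\ \text{ if the channel is singular},\qquad R\le I(X;Y)+\frac{H(\Gamma)}{n}+\frac{\mathcal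 E}{n}\ \text{ if it is non-singular},$$ where $\mathcal E=2H(\overline\Gamma_1,\overline\Gamma_2,\overline{\overline\Gamma})+7\Delta+3+2\log e$. (If an entropy on the right-hand side is infinite, the corresponding bound holds trivially.) -/

import Mathlib

open MeasureTheory ProbabilityTheory
open scoped ENNReal

noncomputable section

namespace ChannelSynthesis

/-! ### Information measures (in bits) -/

/-- Shannon entropy, in bits, of a law on a countable alphabet. -/
def entropy {α : Type*} [MeasurableSpace α] (μ : Measure α) : ℝ≥0∞ :=
  ∑' a, ENNReal.ofReal (Real.negMulLog (μ.real {a}) / Real.log 2)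

/-- Mutual information `I(X;Y)`, in bits, for `X ∼ P` and channel `κ`: the divergence of the joint
law from the product of its marginals. -/
def mutualInfo {𝒳 𝒴 : Type*} [MeasurableSpace 𝒳] [MeasurableSpace 𝒴]
    (P : Measure 𝒳) (κ : Kernel 𝒳 𝒴) : ℝ≥0∞ :=
  InformationTheory.klDiv (P ⊗ₘ κ) (P.prod (κ ∘ₘ P)) / ENNReal.ofReal (Real.log 2)

/-! ### Codes with common randomness -/

/-- No string of the set is a prefix of a different string of the set. -/
def IsPrefixFree (S : Set (List Bool)) : Prop :=
  ∀ a ∈ S, ∀ b ∈ S, a <+: b → a = b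

/-- A code for simulating a channel from `𝒳` to `𝒴`: the law of the common randomness, an encoder
whose range is prefix-free for each realization of the common randomness, and a decoder. -/
structure Code (𝒰 𝒳 𝒴 : Type*) [MeasurableSpace 𝒰] where
  law : Measure 𝒰
  isProb : IsProbabilityMeasure law
  enc : 𝒳 → 𝒰 → List Bool
  dec : List Bool → 𝒰 → 𝒴
  prefixFree : ∀ u, IsPrefixFree (Set.range fun x => enc x u)

/-- With `X ∼ P` independent of the common randomness `U`, the pair `(X, g(f(X,U),U))` has the
law induced by the source `P` and the channel `κ`. -/
def Code.Simulates {𝒰 𝒳 𝒴 : Type*} [MeasurableSpace 𝒰] [MeasurableSpace 𝒳] [MeasurableSpace 𝒴]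
    (Φ : Code 𝒰 𝒳 𝒴) (P : Measure 𝒳) (κ : Kernel 𝒳 𝒴) : Prop :=
  AEMeasurable (fun z : 𝒳 × 𝒰 => (z.1, Φ.dec (Φ.enc z.1 z.2) z.2)) (P.prod Φ.law) ∧
    (P.prod Φ.law).map (fun z => (z.1, Φ.dec (Φ.enc z.1 z.2) z.2)) = P ⊗ₘ κ

/-- The average rate `(1/n) 𝔼[ℓ(f(Xⁿ,U))]`. -/
def Code.rate {𝒰 𝒳 𝒴 : Type*} [MeasurableSpace 𝒰] [MeasurableSpace 𝒳]
    (Φ : Code 𝒰 𝒳 𝒴) (n : ℕ) (P : Measure 𝒳) : ℝ≥0∞ :=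
  (∫⁻ z, ((Φ.enc z.1 z.2).length : ℝ≥0∞) ∂(P.prod Φ.law)) / n

/-! ### Optimal prefix-free codes for a discrete law -/

/-- The set of symbols of positive probability. -/
def atoms {α : Type*} [MeasurableSpace α] (μ : Measure α) : Set α := {a | μ {a} ≠ 0}

/-- `c` is a (lossless) prefix-free code for the symbols of positive probability. -/
def IsPrefixCode {α : Type*} [MeasurableSpace α] (μ : Measure α) (c : α → List Bool) : Prop :=
  ∀ a ∈ atoms μ, ∀ b ∈ atoms μ, c a <+: c b → a = b

/-- Expected codeword length. -/
def expectedLength {α : Type*} [MeasurableSpace α] (μ : Measure α) (c : α → List Bool) : ℝ≥0∞ :=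
  ∑' a, μ {a} * ((c a).length : ℝ≥0∞)

/-- `c` is an optimal prefix-free code for `μ`. -/
def IsOptimalCode {α : Type*} [MeasurableSpace α] (μ : Measure α) (c : α → List Bool) : Prop :=
  IsPrefixCode μ c ∧ ∀ c', IsPrefixCode μ c' → expectedLength μ c ≤ expectedLength μ c'

/-- Replaces a symbol of probability zero (an event of probability zero when symbols are drawn
from `μ`) by some fixed symbol of positive probability, which the code for `μ` can represent. -/
def toAtom {α : Type*} [Nonempty α] [MeasurableSpace α] (μ : Measure α) (a : α) : α :=
  open Classical in if a ∈ atoms μ then a else Classical.epsilon fun b => b ∈ atoms μ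

lemma toAtom_mem {α : Type*} [Nonempty α] [Countable α] [MeasurableSpace α]
    (μ : Measure α) [IsProbabilityMeasure μ] (a : α) : toAtom μ a ∈ atoms μ := by
  classical
  unfold toAtom
  split_ifs with h
  · exact h
  · refine Classical.epsilon_spec (p := fun b => b ∈ atoms μ) ?_
    by_contra hne
    push Not at hne
    have h0 : μ Set.univ = 0 := by
      rw [← Set.iUnion_of_singleton]
      exact measure_iUnion_null fun b => by simpa [atoms] using hne b
    simp at h0

/-- Optimal prefix-free codes exist on every countable alphabet. -/
lemma exists_isOptimalCode {α : Type*} [Countable α] [MeasurableSpace α]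
    (μ : Measure α) [IsFiniteMeasure μ] : ∃ c, IsOptimalCode μ c := by
  classical
  have hne : ∃ c, IsPrefixCode μ c := by
    obtain ⟨e, he⟩ := exists_injective_nat α
    refine ⟨fun a => List.replicate (e a) true ++ [false], fun a _ b _ h => he ?_⟩
    by_contra hab
    rcases lt_or_gt_of_ne hab with hlt | hlt
    · have := h.getElem (i := e a) (by simp)
      simp [hlt] at this
    · have := h.length_le
      simp at this
      omega
  set L : ℝ≥0∞ := ⨅ c : {c // IsPrefixCode μ c}, expectedLength μ c.1 with hL
  by_cases htop : L = ∞
  · obtain ⟨c, hc⟩ := hne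
    refine ⟨c, hc, fun c' hc' => ?_⟩
    have : L ≤ expectedLength μ c' := iInf_le (fun c : {c // IsPrefixCode μ c} => _) ⟨c', hc'⟩
    rw [htop, top_le_iff] at this
    simp [this]
  have hseq : ∀ k : ℕ, ∃ c, IsPrefixCode μ c ∧ expectedLength μ c ≤ L + ((k : ℝ≥0∞) + 1)⁻¹ := by
    intro k
    have hlt : L < L + ((k : ℝ≥0∞) + 1)⁻¹ :=
      ENNReal.lt_add_right htop (ENNReal.inv_ne_zero.2 (by simp))
    obtain ⟨c, hc⟩ := iInf_lt_iff.1 (hL ▸ hlt)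
    exact ⟨c.1, c.2, hc.le⟩
  choose c hc hcL using hseq
  let F : Ultrafilter ℕ := Filter.hyperfilter ℕ
  have hlim : ∀ a, ∃ w, a ∈ atoms μ → ∀ᶠ k in (F : Filter ℕ), c k a = w := by
    intro a
    by_cases ha : a ∈ atoms μ
    swap
    · exact ⟨[], fun h => absurd h ha⟩
    have hB : (L + 1) / μ {a} ≠ ∞ := ENNReal.div_ne_top (by simp [htop]) ha
    obtain ⟨N, hN⟩ := ENNReal.exists_nat_gt hB
    have hlen : ∀ k, (c k a).length ≤ N := by
      intro k
      have h1 : μ {a} * ((c k a).length : ℝ≥0∞) ≤ L + 1 := by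
        refine (ENNReal.le_tsum a).trans ((hcL k).trans ?_)
        gcongr
        exact ENNReal.inv_le_one.2 (by simp)
      have h2 : ((c k a).length : ℝ≥0∞) ≤ (L + 1) / μ {a} := by
        rw [ENNReal.le_div_iff_mul_le (Or.inl ha) (Or.inl (measure_ne_top _ _)), mul_comm]
        exact h1
      exact_mod_cast (h2.trans hN.le)
    have hfin : {l : List Bool | l.length ≤ N}.Finite := List.finite_length_le Bool N
    obtain ⟨w, -, hw⟩ := Ultrafilter.eq_pure_of_finite_mem (f := F.map fun k => c k a) hfin
      (by
        change ∀ᶠ k in (F : Filter ℕ), (c k a).length ≤ N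
        exact Filter.Eventually.of_forall hlen)
    refine ⟨w, fun _ => ?_⟩
    have : {w} ∈ F.map fun k => c k a := by rw [hw]; simp
    exact this
  choose w hw using hlim
  have hpre : IsPrefixCode μ w := by
    intro a ha b hb hab
    obtain ⟨k, hk1, hk2⟩ := ((hw a ha).and (hw b hb)).exists
    exact hc k a ha b hb (by rw [hk1, hk2]; exact hab)
  have hle : expectedLength μ w ≤ L := by
    rw [expectedLength, ENNReal.tsum_eq_iSup_sum]
    refine iSup_le fun s => ?_
    have hev : ∀ᶠ k in (F : Filter ℕ), ∀ a ∈ s,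
        μ {a} * ((w a).length : ℝ≥0∞) = μ {a} * ((c k a).length : ℝ≥0∞) := by
      rw [Filter.eventually_all_finset]
      intro a _
      by_cases ha : a ∈ atoms μ
      · filter_upwards [hw a ha] with k hk
        rw [hk]
      · have : μ {a} = 0 := by simpa [atoms] using ha
        simp [this]
    have htend : Filter.Tendsto (fun k : ℕ => L + ((k : ℝ≥0∞) + 1)⁻¹) F (nhds (L + 0)) := by
      have hF : (F : Filter ℕ) ≤ Filter.atTop := by
        rw [← Nat.cofinite_eq_atTop]; exact Filter.hyperfilter_le_cofinite
      refine Filter.Tendsto.mono_left ?_ hF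
      refine Filter.Tendsto.const_add _ ?_
      have := (Filter.tendsto_add_atTop_iff_nat 1).2 ENNReal.tendsto_inv_nat_nhds_zero
      simpa using this
    rw [add_zero] at htend
    refine ge_of_tendsto htend ?_
    filter_upwards [hev] with k hk
    rw [Finset.sum_congr rfl hk]
    exact (ENNReal.sum_le_tsum s).trans (hcL k)
  refine ⟨w, hpre, fun c' hc' => hle.trans ?_⟩
  exact iInf_le (fun c : {c // IsPrefixCode μ c} => expectedLength μ c.1) ⟨c', hc'⟩

/-- Unique parsing of the first codeword in a concatenation. -/
lemma IsPrefixCode.append {α : Type*} [MeasurableSpace α] {μ : Measure α} {c : α → List Bool}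
    (hc : IsPrefixCode μ c) {a b : α} (ha : a ∈ atoms μ) (hb : b ∈ atoms μ) {r s : List Bool}
    (h : c a ++ r <+: c b ++ s) : a = b ∧ r <+: s := by
  have h1 : c a <+: c b ++ s := (List.prefix_append _ _).trans h
  have h2 : c b <+: c b ++ s := List.prefix_append _ _
  have hab : a = b := by
    rcases List.prefix_or_prefix_of_prefix h1 h2 with h3 | h3
    · exact hc a ha b hb h3
    · exact (hc b hb a ha h3).symm
  subst hab
  exact ⟨rfl, (List.prefix_append_right_inj _).1 h⟩

/-! ### Sampling -/

/-- Inverse-transform sampling: turns a uniform `v` into a sample from the law `q` on a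
countably infinite alphabet (enumerated as `0, 1, 2, …`). -/
def sample {α : Type*} [Denumerable α] [MeasurableSpace α] (q : Measure α) (v : unitInterval) : α :=
  Denumerable.ofNat α
    (sInf {k : ℕ | (v : ℝ) < ∑ i ∈ Finset.range (k + 1), q.real {Denumerable.ofNat α i}})

/-- The index selected by rejection sampling with likelihood ratio `r`, ceiling `M`, codebook `c`
and uniform variables `v`: the first `i` with `v i ≤ r (c i) / M`. Indices start at `0`. -/
def rejectionIndex {α : Type*} (M : ℝ) (r : α → ℝ≥0∞) (c : ℕ → α) (v : ℕ → unitInterval) : ℕ :=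
  sInf {i : ℕ | ENNReal.ofReal (v i) ≤ r (c i) / ENNReal.ofReal M}

/-- The success probability `1 / M`, as a point of the unit interval. -/
def successProb (M : ℝ) : unitInterval := Set.projIcc 0 1 zero_le_one (1 / M)

/-- Law of the (`0`-based) index selected by rejection sampling with ceiling `M`: the geometric law
with success probability `1 / M`. -/
def indexLaw (M : ℝ) : Measure ℕ := geometricMeasure (successProb M)

instance (M : ℝ) : IsProbabilityMeasure (indexLaw M) := by
  unfold indexLaw; infer_instance

/-! ### The quantized log-likelihood ratios -/

section Scheme

variable {𝒳 𝒴 : Type*} [MeasurableSpace 𝒳] [StandardBorelSpace 𝒳]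
  [MeasurableSpace 𝒴] [StandardBorelSpace 𝒴] [Nonempty 𝒴]
  (P : Measure 𝒳) [IsProbabilityMeasure P] (κ : Kernel 𝒳 𝒴) [IsMarkovKernel κ] (Δ : ℝ)

/-- The density `dp_{Y|X} / dp_Y (y | x)` (in its jointly measurable version). -/
def density (z : 𝒳 × 𝒴) : ℝ≥0∞ := κ.rnDeriv (Kernel.const 𝒳 (κ ∘ₘ P)) z.1 z.2

/-- The joint law is singular: the density `dp_{Y|X} / dp_Y (Y | X)` is almost surely a
deterministic function of `Y`. -/
def IsSingular : Prop :=
  ∃ h : 𝒴 → ℝ≥0∞, Measurable h ∧ ∀ᵐ z ∂(P ⊗ₘ κ), density P κ z = h z.2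

/-- Index of the cell `[jΔ, (j+1)Δ)` that contains `t`. The uniform quantizer is
`Q_Δ(t) = Δ * cell Δ t`; quantized variables are represented below by their cell index. -/
def cell (t : ℝ) : ℤ := ⌊t / Δ⌋

/-- `Γ`: the quantized log-likelihood ratio `log₂ (dp_{Y|X} / dp_Y)`. -/
def gam (z : 𝒳 × 𝒴) : ℤ := cell Δ (Real.logb 2 (density P κ z).toReal)

/-- The law `p_Γ`. -/
def gamLaw : Measure ℤ := (P ⊗ₘ κ).map (gam P κ Δ)

/-- The conditional law `p_{Γ|X}`. -/
def gamGivenX : Kernel 𝒳 ℤ := condDistrib (gam P κ Δ) Prod.fst (P ⊗ₘ κ)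

/-- `Γ̄₁`: the quantized `log₂ (1 / p_{Γ|X}(Γ|X))`. -/
def gamBar₁ (z : 𝒳 × 𝒴) : ℤ :=
  cell Δ (Real.logb 2 (1 / (gamGivenX P κ Δ z.1).real {gam P κ Δ z}))

/-- `Γ̄₂`: the quantized `log₂ (1 / p_Γ(Γ))`. -/
def gamBar₂ (z : 𝒳 × 𝒴) : ℤ :=
  cell Δ (Real.logb 2 (1 / (gamLaw P κ Δ).real {gam P κ Δ z}))

/-- The pair `(Γ̄₁, Γ̄₂)`. -/
def gamBars (z : 𝒳 × 𝒴) : ℤ × ℤ := (gamBar₁ P κ Δ z, gamBar₂ P κ Δ z)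

/-- `Γ̄̄`: the quantized `log₂ (1 / p_{Γ̄₁,Γ̄₂|X}(Γ̄₁,Γ̄₂|X))`. -/
def gamBarBar (z : 𝒳 × 𝒴) : ℤ :=
  cell Δ (Real.logb 2
    (1 / (condDistrib (gamBars P κ Δ) Prod.fst (P ⊗ₘ κ) z.1).real {gamBars P κ Δ z}))

/-- The triple `(Γ̄₁, Γ̄₂, Γ̄̄)` that is communicated losslessly. -/
def side (z : 𝒳 × 𝒴) : ℤ × ℤ × ℤ := (gamBar₁ P κ Δ z, gamBar₂ P κ Δ z, gamBarBar P κ Δ z)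

/-- The law of `(Γ̄₁, Γ̄₂, Γ̄̄)`. -/
def sideLaw : Measure (ℤ × ℤ × ℤ) := (P ⊗ₘ κ).map (side P κ Δ)

/-- The conditional law of `(Γ̄₁, Γ̄₂, Γ̄̄)` given `X`. -/
def sideGivenX : Kernel 𝒳 (ℤ × ℤ × ℤ) := condDistrib (side P κ Δ) Prod.fst (P ⊗ₘ κ)

/-! Measurability of these variables. -/

lemma measurable_cell : Measurable (cell Δ) :=
  Int.measurable_floor.comp (measurable_id.div_const Δ)

set_option linter.unusedSectionVars false in
lemma measurable_gam : Measurable (gam P κ Δ) := by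
  have h : Measurable (density P κ) := Kernel.measurable_rnDeriv _ _
  exact (measurable_cell Δ).comp
    ((Real.measurable_log.comp h.ennreal_toReal).div_const _)

set_option linter.unusedSectionVars false in
lemma measurable_logSelfInfo {α : Type*} [MeasurableSpace α] [Countable α]
    [MeasurableSingletonClass α] (η : Kernel 𝒳 α) {f : 𝒳 × 𝒴 → α} (hf : Measurable f) :
    Measurable fun z => cell Δ (Real.logb 2 (1 / (η z.1).real {f z})) := by
  have h : Measurable fun p : 𝒳 × α => η p.1 {p.2} :=
    measurable_from_prod_countable_left fun a => η.measurable_coe (measurableSet_singleton a)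
  have h' : Measurable fun z : 𝒳 × 𝒴 => (η z.1).real {f z} :=
    (h.comp (measurable_fst.prodMk hf)).ennreal_toReal
  exact (measurable_cell Δ).comp
    ((Real.measurable_log.comp (measurable_const.div h')).div_const _)

lemma measurable_side : Measurable (side P κ Δ) := by
  have h1 : Measurable (gamBar₁ P κ Δ) :=
    measurable_logSelfInfo Δ (gamGivenX P κ Δ) (measurable_gam P κ Δ)
  have h2 : Measurable (gamBar₂ P κ Δ) :=
    measurable_logSelfInfo Δ (Kernel.const 𝒳 (gamLaw P κ Δ)) (measurable_gam P κ Δ)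
  have h3 : Measurable (gamBarBar P κ Δ) := measurable_logSelfInfo Δ
    (condDistrib (gamBars P κ Δ) Prod.fst (P ⊗ₘ κ)) (h1.prodMk h2)
  exact h1.prodMk (h2.prodMk h3)

instance : IsProbabilityMeasure (gamLaw P κ Δ) :=
  Measure.isProbabilityMeasure_map (measurable_gam P κ Δ).aemeasurable

instance : IsProbabilityMeasure (sideLaw P κ Δ) :=
  Measure.isProbabilityMeasure_map (measurable_side P κ Δ).aemeasurable

/-! ### The two-stage scheme -/

/-- The ceiling `τ_aux = 2 ^ (γ̄ + 3Δ + γ̄̄)` with `γ̄ = γ̄₂ - γ̄₁`. -/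
def tauAux (t : ℤ × ℤ × ℤ) : ℝ :=
  2 ^ ((Δ * t.2.1 - Δ * t.1) + 3 * Δ + Δ * t.2.2 : ℝ)

/-- The ceiling of the second stage: `τ = 2 ^ (γ - γ̄ + 2Δ)` in the singular case and
`τ = 2 ^ (γ + γ̄₁ + 2Δ)` otherwise. -/
def tauPrimary (t : ℤ × ℤ × ℤ) (g : ℤ) : ℝ :=
  open Classical in
  if IsSingular P κ then 2 ^ (Δ * g - (Δ * t.2.1 - Δ * t.1) + 2 * Δ : ℝ)
  else 2 ^ (Δ * g + Δ * t.1 + 2 * Δ : ℝ)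

/-- The likelihood ratio `p_{Γ|X,Γ̄₁,Γ̄₂}(γ | x, γ̄₁, γ̄₂) / p_Γ(γ)` used in the first stage. -/
def ratioAux (a : 𝒳 × ℤ × ℤ) (g : ℤ) : ℝ≥0∞ :=
  (condDistrib (gam P κ Δ) (fun z => (z.1, gamBars P κ Δ z)) (P ⊗ₘ κ)).rnDeriv
    (Kernel.const _ (gamLaw P κ Δ)) a g

/-- The proposal law `W` of the second stage, as a function of `γ`: it is `p_{Y|Γ}(·|γ)` in the
singular case and `p_Y` otherwise. -/
def proposal : Kernel ℤ 𝒴 :=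
  open Classical in
  if IsSingular P κ then condDistrib Prod.snd (gam P κ Δ) (P ⊗ₘ κ) else Kernel.const ℤ (κ ∘ₘ P)

instance : IsMarkovKernel (proposal P κ Δ) := by
  unfold proposal; split_ifs <;> infer_instance

/-- The likelihood ratio `dp_{Y|X,Γ}(·|x,γ) / dW` used in the second stage. -/
def ratioPrimary (a : 𝒳 × ℤ) (y : 𝒴) : ℝ≥0∞ :=
  (condDistrib Prod.snd (fun z => (z.1, gam P κ Δ z)) (P ⊗ₘ κ)).rnDeriv
    ((proposal P κ Δ).comap Prod.snd measurable_snd) a y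

/-- The entropy codes of the scheme: an optimal prefix-free code for `(Γ̄₁, Γ̄₂, Γ̄̄)`, and for each
ceiling `M` an optimal prefix-free code for the geometric law with success probability `1 / M`. -/
structure EntropyCodes where
  sideWord : ℤ × ℤ × ℤ → List Bool
  side_optimal : IsOptimalCode (sideLaw P κ Δ) sideWord
  indexWord : ℝ → ℕ → List Bool
  index_optimal : ∀ M, IsOptimalCode (indexLaw M) (indexWord M)

instance : Nonempty (EntropyCodes P κ Δ) := by
  obtain ⟨c, hc⟩ := exists_isOptimalCode (sideLaw P κ Δ)
  choose d hd using fun M : ℝ => exists_isOptimalCode (indexLaw M)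
  exact ⟨⟨c, hc, d, hd⟩⟩

/-- The common randomness: a uniform variable used to draw `(γ̄₁, γ̄₂, γ̄̄)` given `x`; the codebook
for `γ`; the uniform variables of the first rejection sampler; for each `γ` a codebook for `y`; the
uniform variables of the second rejection sampler. -/
abbrev Seeds (𝒴 : Type*) : Type _ :=
  unitInterval × (ℕ → ℤ) × (ℕ → unitInterval) × (ℤ → ℕ → 𝒴) × (ℕ → unitInterval)

/-- All components of the common randomness are independent. -/
def seedLaw : Measure (Seeds 𝒴) :=
  (volume : Measure unitInterval).prod <|
    (Measure.infinitePi fun _ : ℕ => gamLaw P κ Δ).prod <|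
    (Measure.infinitePi fun _ : ℕ => (volume : Measure unitInterval)).prod <|
    (Measure.infinitePi fun g : ℤ => Measure.infinitePi fun _ : ℕ => proposal P κ Δ g).prod <|
    Measure.infinitePi fun _ : ℕ => (volume : Measure unitInterval)

instance : IsProbabilityMeasure (seedLaw P κ Δ) := by
  unfold seedLaw; infer_instance

/-- The triple `(γ̄₁, γ̄₂, γ̄̄)` drawn from its conditional law given `X = x`. -/
def sentSide (x : 𝒳) (u : Seeds 𝒴) : ℤ × ℤ × ℤ :=
  toAtom (sideLaw P κ Δ) (sample (sideGivenX P κ Δ x) u.1)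

/-- The index `K` selected by the first rejection sampler. -/
def sentK (x : 𝒳) (u : Seeds 𝒴) : ℕ :=
  let t := sentSide P κ Δ x u
  toAtom (indexLaw (tauAux Δ t))
    (rejectionIndex (tauAux Δ t) (ratioAux P κ Δ (x, t.1, t.2.1)) u.2.1 u.2.2.1)

/-- The value `γ` selected by the first rejection sampler. -/
def selectedGam (x : 𝒳) (u : Seeds 𝒴) : ℤ := u.2.1 (sentK P κ Δ x u)

/-- The index `J` selected by the second rejection sampler. -/
def sentJ (x : 𝒳) (u : Seeds 𝒴) : ℕ :=
  let τ := tauPrimary P κ Δ (sentSide P κ Δ x u) (selectedGam P κ Δ x u)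
  let g := selectedGam P κ Δ x u
  toAtom (indexLaw τ) (rejectionIndex τ (ratioPrimary P κ Δ (x, g)) (u.2.2.2.1 g) u.2.2.2.2)

/-- The string that describes the triple `t` and the indices `k` and `j`. -/
def codeword (C : EntropyCodes P κ Δ) (u : Seeds 𝒴) (t : ℤ × ℤ × ℤ) (k j : ℕ) : List Bool :=
  C.sideWord t ++ (C.indexWord (tauAux Δ t) k ++ C.indexWord (tauPrimary P κ Δ t (u.2.1 k)) j)

/-- The decoder: it parses the triple and the two indices, and outputs the selected entry of the
codebook for the selected `γ`. -/
def decode (C : EntropyCodes P κ Δ) (w : List Bool) (u : Seeds 𝒴) : 𝒴 :=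
  let s : (ℤ × ℤ × ℤ) × ℕ × ℕ := Classical.epsilon fun s =>
    s.1 ∈ atoms (sideLaw P κ Δ) ∧ s.2.1 ∈ atoms (indexLaw (tauAux Δ s.1)) ∧
      s.2.2 ∈ atoms (indexLaw (tauPrimary P κ Δ s.1 (u.2.1 s.2.1))) ∧
      codeword P κ Δ C u s.1 s.2.1 s.2.2 = w
  u.2.2.2.1 (u.2.1 s.2.1) s.2.2

/-- The proposed two-stage scheme. -/
def scheme (C : EntropyCodes P κ Δ) : Code (Seeds 𝒴) 𝒳 𝒴 where
  law := seedLaw P κ Δ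
  isProb := inferInstance
  enc x u := codeword P κ Δ C u (sentSide P κ Δ x u) (sentK P κ Δ x u) (sentJ P κ Δ x u)
  dec := decode P κ Δ C
  prefixFree := by
    rintro u _ ⟨x, rfl⟩ _ ⟨x', rfl⟩ h
    have hk : ∀ x, sentK P κ Δ x u ∈ atoms (indexLaw (tauAux Δ (sentSide P κ Δ x u))) :=
      fun x => toAtom_mem _ _
    have hj : ∀ x, sentJ P κ Δ x u ∈ atoms (indexLaw
        (tauPrimary P κ Δ (sentSide P κ Δ x u) (u.2.1 (sentK P κ Δ x u)))) :=
      fun x => toAtom_mem _ _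
    simp only [codeword] at h ⊢
    obtain ⟨h1, h⟩ := C.side_optimal.1.append (toAtom_mem _ _) (toAtom_mem _ _) h
    change sentSide P κ Δ x u = sentSide P κ Δ x' u at h1
    have hkx := hk x
    have hjx := hj x
    rw [h1] at h hkx hjx ⊢
    obtain ⟨h2, h⟩ := (C.index_optimal _).1.append hkx (hk x') h
    rw [h2] at h hjx ⊢
    rw [(C.index_optimal _).1 _ hjx _ (hj x') h]

end Scheme

/-! ### Blocks of length `n` -/

section Block

variable {𝒳 𝒴 : Type*} [MeasurableSpace 𝒳] [MeasurableSpace 𝒴]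

/-- The law of `Xⁿ`, i.i.d. from `P`. -/
def blockSource (P : Measure 𝒳) (n : ℕ) : Measure (Fin n → 𝒳) := Measure.pi fun _ => P

instance (P : Measure 𝒳) [IsProbabilityMeasure P] (n : ℕ) :
    IsProbabilityMeasure (blockSource P n) := by
  unfold blockSource; infer_instance

/-- The memoryless channel `p_{Yⁿ|Xⁿ}(·|xⁿ) = ∏ᵢ p_{Y|X}(·|xᵢ)`. -/
def blockChannel (κ : Kernel 𝒳 𝒴) [IsMarkovKernel κ] (n : ℕ) :
    Kernel (Fin n → 𝒳) (Fin n → 𝒴) where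
  toFun x := Measure.pi fun i => κ (x i)
  measurable' := by
    refine Measurable.measure_of_isPiSystem_of_isProbabilityMeasure generateFrom_pi.symm
      isPiSystem_pi ?_
    rintro _ ⟨s, hs, rfl⟩
    simp only [Measure.pi_pi]
    exact Finset.measurable_prod _ fun i _ =>
      (κ.measurable_coe (hs i (Set.mem_univ i))).comp (measurable_pi_apply i)

instance (κ : Kernel 𝒳 𝒴) [IsMarkovKernel κ] (n : ℕ) : IsMarkovKernel (blockChannel κ n) :=
  ⟨fun x => by change IsProbabilityMeasure (Measure.pi fun i => κ (x i)); infer_instance⟩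

end Block

/-- The error term `2 H(Γ̄₁, Γ̄₂, Γ̄̄) + 7Δ + 3 + 2 log₂ e`. -/
def errorTerm {𝒳 𝒴 : Type*} [MeasurableSpace 𝒳] [StandardBorelSpace 𝒳]
    [MeasurableSpace 𝒴] [StandardBorelSpace 𝒴] [Nonempty 𝒴]
    (P : Measure 𝒳) [IsProbabilityMeasure P] (κ : Kernel 𝒳 𝒴) [IsMarkovKernel κ] (Δ : ℝ) : ℝ≥0∞ :=
  2 * entropy (sideLaw P κ Δ) + ENNReal.ofReal (7 * Δ + 3 + 2 * Real.logb 2 (Real.exp 1))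

end ChannelSynthesis

end

open ChannelSynthesis

/-!
Write `X`, `Y` for an input and an output of the channel `κ` with source `P`; the theorem concerns
this one-shot situation for the block source and the block channel, up to the last step.

*Simulation.* For almost every input `x`, each conditional law given `X = x` that occurs in the
scheme is the law of a function of `Y ∼ κ x`, and conditioning on a further discrete variable is
elementary conditioning of `κ x` on an event of positive probability (`condDistrib_fst_ae`,
`condDistrib_pair_ae`, collected in `GoodInput`). The quantized variables are chosen so that each
likelihood ratio is at most the ceiling of its stage, whose powers of `2 ^ Δ` make up for the
rounding (`GoodInput.target_aux_le`, `GoodInput.target_primary_le`). Rejection sampling is therefore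
exact: the selected entry has the target law, and the selected index is geometric and independent
of it (`map_rejectionIndex`). Hence `GoodInput.lintegral_seedLaw` gives the joint law of everything
that is sent and of the output, and its last marginal is `κ x` (`scheme_simulates`).

*Rate.* By the converse of Kraft's inequality (`exists_prefixFree_of_kraft`), an optimal
prefix-free code costs at most one bit more than the entropy, and for the index of a rejection
sampler with ceiling `M` this is at most `log₂ M + log₂ e + 1` bits
(`expectedLength_indexLaw_le`). The logarithms of the two ceilings add up to `Γ + Γ̄̄ + 5Δ` in
the singular case and to `Γ + Γ̄₂ + Γ̄̄ + 5Δ` otherwise. A quantized variable is at most the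
variable itself, so the expectation of `Γ` is at most the mutual information, that of `Γ̄₂` at
most the entropy of `Γ`, and that of `Γ̄̄` at most the conditional entropy of the triple given
the input, which Jensen's inequality bounds by its entropy (`lintegral_conditional_selfInfo_le`).
The sum is `lintegral_length_le_mutualInfo`.

*Blocks.* The pairs of letters of a block are i.i.d., so the chain rule for relative entropy bounds
the mutual information of the block by `n` times the one-letter mutual information
(`mutualInfo_block_le`); division by `n` gives the rate.
-/

open MeasureTheory ProbabilityTheory
open scoped ENNReal

noncomputable section

namespace ChannelSynthesis

/-! ### Kraft's inequality and the length of optimal prefix-free codes -/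

/-- The `m` lowest binary digits of `N`, most significant first. -/
def bits : ℕ → ℕ → List Bool
  | 0, _ => []
  | m + 1, N => bits m (N / 2) ++ [decide (N % 2 = 1)]

lemma length_bits (m N : ℕ) : (bits m N).length = m := by
  induction m generalizing N with
  | zero => rfl
  | succ m ih => simp [bits, ih]

/-- The first `m` of the `m + k` lowest digits of `M` are the digits of `M / 2 ^ k`. -/
lemma bits_add (m k M : ℕ) : ∃ r, bits (m + k) M = bits m (M / 2 ^ k) ++ r := by
  induction k generalizing M with
  | zero => exact ⟨[], by simp⟩
  | succ k ih =>
    obtain ⟨r, hr⟩ := ih (M / 2)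
    refine ⟨r ++ [decide (M % 2 = 1)], ?_⟩
    rw [← add_assoc, bits, hr, Nat.div_div_eq_div_mul, ← pow_succ', List.append_assoc]

lemma bits_injOn {m N M : ℕ} (hN : N < 2 ^ m) (hM : M < 2 ^ m) (h : bits m N = bits m M) :
    N = M := by
  induction m generalizing N M with
  | zero => simp at hN hM; omega
  | succ m ih =>
    simp only [bits] at h
    obtain ⟨h1, h2⟩ := List.append_inj h (by simp [length_bits])
    have h3 := ih (by omega) (by omega) h1
    simp at h2
    by_cases h4 : N % 2 = 1 <;> simp [h4] at h2 <;> omega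

/-- A string of `m` digits is a prefix of a string of `m'` digits only if the dyadic interval of the
second is contained in that of the first. -/
lemma eq_div_of_bits_prefix {m m' N M : ℕ} (hN : N < 2 ^ m) (hM : M < 2 ^ m')
    (h : bits m N <+: bits m' M) : m ≤ m' ∧ N = M / 2 ^ (m' - m) := by
  have hle : m ≤ m' := by simpa [length_bits] using h.length_le
  obtain ⟨k, rfl⟩ := Nat.exists_eq_add_of_le hle
  refine ⟨hle, ?_⟩
  rw [Nat.add_sub_cancel_left]
  obtain ⟨r, hr⟩ := bits_add m k M
  rw [hr] at h
  have h2 := (List.prefix_append (bits m (M / 2 ^ k)) r)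
  have h3 : bits m N = bits m (M / 2 ^ k) := by
    rcases List.prefix_or_prefix_of_prefix h h2 with h4 | h4
    · exact h4.eq_of_length (by simp [length_bits])
    · exact (h4.eq_of_length (by simp [length_bits])).symm
  refine bits_injOn hN ?_ h3
  rw [Nat.div_lt_iff_lt_mul (by positivity), ← pow_add]
  exact hM

/-- The converse of Kraft's inequality on a countable alphabet. Symbols are ordered by length, ties
being broken by an enumeration, so that each symbol has finitely many predecessors; the word of `a`
consists of the first `l a` binary digits of the Kraft sum of the predecessors of `a`. -/
lemma exists_prefixFree_of_kraft {α : Type*} [Countable α] (l : α → ℕ)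
    (h : ∑' a, ((2 : ℝ≥0∞)⁻¹) ^ l a ≤ 1) :
    ∃ c : α → List Bool, (∀ a, (c a).length = l a) ∧ ∀ a b, c a <+: c b → a = b := by
  classical
  obtain ⟨e, he⟩ := exists_injective_nat α
  let key : α → ℕ ×ₗ ℕ := fun a => toLex (l a, e a)
  have hkey : Function.Injective key := fun a b hab =>
    he (by simpa [key] using congrArg (fun z => (ofLex z).2) hab)
  have hfin : ∀ a, {b | key b < key a}.Finite := by
    intro a
    have h1 : {b | ((2 : ℝ≥0∞)⁻¹) ^ l a ≤ ((2 : ℝ≥0∞)⁻¹) ^ l b}.Finite :=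
      ENNReal.finite_const_le_of_tsum_ne_top (ne_top_of_le_ne_top (by simp) h) (by simp)
    refine h1.subset fun b hb => ?_
    have hb' : l b ≤ l a := by
      have : key b < key a := hb
      rw [Prod.Lex.lt_iff] at this
      simp only [key, ofLex_toLex] at this
      omega
    exact pow_le_pow_right_of_le_one' (ENNReal.inv_le_one.2 (by norm_num)) hb'
  let B : α → Finset α := fun a => (hfin a).toFinset
  have hB : ∀ a b, b ∈ B a ↔ key b < key a := fun a b => by simp [B]
  have hl : ∀ a b, key b ≤ key a → l b ≤ l a := by
    intro a b hb
    rw [Prod.Lex.le_iff] at hb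
    simp only [key, ofLex_toLex] at hb
    omega
  -- `N a` is the Kraft sum of the predecessors of `a`, in units of `2 ^ (-l a)`
  let N : α → ℕ := fun a => ∑ b ∈ B a, 2 ^ (l a - l b)
  have hself : ∀ a, a ∉ B a := fun a => by simp [hB]
  have hN1 : ∀ a, N a + 1 = ∑ b ∈ insert a (B a), 2 ^ (l a - l b) := by
    intro a
    rw [Finset.sum_insert (hself a)]
    simp [N, add_comm]
  have hle : ∀ a b, b ∈ insert a (B a) → l b ≤ l a := by
    intro a b hb
    rw [Finset.mem_insert, hB] at hb
    rcases hb with rfl | hb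
    · exact le_rfl
    · exact hl _ _ hb.le
  have hNlt : ∀ a, N a < 2 ^ l a := by
    intro a
    rw [Nat.lt_iff_add_one_le, hN1]
    have h1 : ∑ b ∈ insert a (B a), ((2 : ℝ≥0∞)⁻¹) ^ l b ≤ 1 := (ENNReal.sum_le_tsum _).trans h
    have h2 : (2 : ℝ≥0∞) ^ l a * ∑ b ∈ insert a (B a), ((2 : ℝ≥0∞)⁻¹) ^ l b ≤ 2 ^ l a := by
      simpa using mul_le_mul_right h1 ((2 : ℝ≥0∞) ^ l a)
    rw [Finset.mul_sum] at h2
    have h3 : ∀ b ∈ insert a (B a),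
        (2 : ℝ≥0∞) ^ l a * ((2 : ℝ≥0∞)⁻¹) ^ l b = ((2 ^ (l a - l b) : ℕ) : ℝ≥0∞) := by
      intro b hb
      have := hle a b hb
      conv_lhs => rw [← Nat.sub_add_cancel this, pow_add, mul_assoc, ← mul_pow,
        ENNReal.mul_inv_cancel (by simp) (by simp)]
      simp
    rw [Finset.sum_congr rfl h3] at h2
    exact_mod_cast h2
  -- the dyadic interval of `b` lies to the right of that of `a` if `a` precedes `b`
  have hstep : ∀ a b, key a < key b → (N a + 1) * 2 ^ (l b - l a) ≤ N b := by
    intro a b hab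
    rw [hN1, Finset.sum_mul]
    have hsub : insert a (B a) ⊆ B b := by
      intro c hc
      rw [Finset.mem_insert, hB] at hc
      rw [hB]
      rcases hc with rfl | hc
      · exact hab
      · exact hc.trans hab
    refine le_trans (le_of_eq ?_) (Finset.sum_le_sum_of_subset hsub)
    refine Finset.sum_congr rfl fun c hc => ?_
    rw [← pow_add]
    have h1 := hle a c hc
    have h2 := hl _ _ hab.le
    congr 1
    omega
  refine ⟨fun a => bits (l a) (N a), fun a => length_bits _ _, fun a b hab => ?_⟩
  obtain ⟨h1, h2⟩ := eq_div_of_bits_prefix (hNlt a) (hNlt b) hab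
  rcases lt_trichotomy (key a) (key b) with h3 | h3 | h3
  · have h4 := hstep a b h3
    rw [← Nat.le_div_iff_mul_le (by positivity)] at h4
    omega
  · exact hkey h3
  · have h4 := hstep b a h3
    have h5 := hl _ _ h3.le
    have h6 : l a = l b := le_antisymm h1 h5
    simp [h6] at h2 h4
    omega

lemma tsum_measure_singleton_eq_one {α : Type*} [Countable α] [MeasurableSpace α]
    [MeasurableSingletonClass α] (μ : Measure α) [IsProbabilityMeasure μ] :
    ∑' a, μ {a} = 1 := by
  have := lintegral_countable' (μ := μ) (fun _ => (1 : ℝ≥0∞))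
  simpa using this.symm

/-- Shannon's bound: an optimal code is at least as good as a code with the word lengths
`⌈log₂ (1 / μ {a})⌉`, which satisfy Kraft's inequality. -/
lemma IsOptimalCode.expectedLength_le {α : Type*} [Countable α] [MeasurableSpace α]
    [MeasurableSingletonClass α] {μ : Measure α} [IsProbabilityMeasure μ] {c : α → List Bool}
    (hc : IsOptimalCode μ c) :
    expectedLength μ c ≤
      ∑' a, μ {a} * ENNReal.ofReal (Real.logb 2 (1 / μ.real {a}) + 1) := by
  classical
  let l : atoms μ → ℕ := fun a => ⌈Real.logb 2 (1 / μ.real {a.1})⌉₊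
  have hpos : ∀ a ∈ atoms μ, 0 < μ.real {a} := fun a ha =>
    ENNReal.toReal_pos ha (measure_ne_top _ _)
  have hkraft : ∑' a, ((2 : ℝ≥0∞)⁻¹) ^ l a ≤ 1 := by
    have h1 : ∀ a : atoms μ, ((2 : ℝ≥0∞)⁻¹) ^ l a ≤ μ {a.1} := by
      intro a
      have hp := hpos a.1 a.2
      have h2 : Real.logb 2 (1 / μ.real {a.1}) ≤ (l a : ℝ) := Nat.le_ceil _
      rw [Real.logb_le_iff_le_rpow (by norm_num) (by positivity), Real.rpow_natCast] at h2
      rw [← ofReal_measureReal, ← ENNReal.ofReal_ofNat 2, ← ENNReal.ofReal_inv_of_pos (by norm_num),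
        ← ENNReal.ofReal_pow (by norm_num)]
      refine ENNReal.ofReal_le_ofReal ?_
      rw [inv_pow]
      rw [div_le_comm₀ hp (by positivity)] at h2
      simpa using h2
    calc ∑' a, ((2 : ℝ≥0∞)⁻¹) ^ l a ≤ ∑' a : atoms μ, μ {a.1} := ENNReal.tsum_le_tsum h1
      _ ≤ ∑' a : α, μ {a} := ENNReal.tsum_comp_le_tsum_of_injective Subtype.val_injective _
      _ = 1 := tsum_measure_singleton_eq_one μ
  obtain ⟨w, hw1, hw2⟩ := exists_prefixFree_of_kraft l hkraft
  let c' : α → List Bool := fun a => if ha : a ∈ atoms μ then w ⟨a, ha⟩ else []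
  have hc' : IsPrefixCode μ c' := by
    intro a ha b hb hab
    simp only [c', ha, hb, dif_pos] at hab
    exact congrArg Subtype.val (hw2 _ _ hab)
  refine (hc.2 c' hc').trans (ENNReal.tsum_le_tsum fun a => ?_)
  by_cases ha : a ∈ atoms μ
  · refine mul_le_mul_right ?_ _
    have hlog : 0 ≤ Real.logb 2 (1 / μ.real {a}) :=
      Real.logb_nonneg (by norm_num) (by
        rw [le_div_iff₀ (hpos a ha), one_mul]; exact measureReal_le_one)
    simp only [c', ha, dif_pos, hw1, l]
    rw [← ENNReal.ofReal_natCast]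
    exact ENNReal.ofReal_le_ofReal (Nat.ceil_lt_add_one hlog).le
  · have : μ {a} = 0 := by simpa [atoms] using ha
    simp [this]

lemma entropy_eq {α : Type*} [MeasurableSpace α] (μ : Measure α) [IsProbabilityMeasure μ] :
    entropy μ = ∑' a, μ {a} * ENNReal.ofReal (Real.logb 2 (1 / μ.real {a})) := by
  refine tsum_congr fun a => ?_
  rw [← ofReal_measureReal (μ := μ), ← ENNReal.ofReal_mul measureReal_nonneg]
  congr 1
  rw [Real.negMulLog, Real.logb, one_div, Real.log_inv]
  ring

lemma logb_one_div_measureReal_nonneg {α : Type*} [MeasurableSpace α] (μ : Measure α)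
    [IsProbabilityMeasure μ] (s : Set α) : 0 ≤ Real.logb 2 (1 / μ.real s) := by
  rcases eq_or_lt_of_le (measureReal_nonneg (μ := μ) (s := s)) with h | h
  · simp [← h]
  · refine Real.logb_nonneg (by norm_num) ?_
    rw [le_div_iff₀ h, one_mul]
    exact measureReal_le_one

lemma IsOptimalCode.expectedLength_le_entropy_add_one {α : Type*} [Countable α]
    [MeasurableSpace α] [MeasurableSingletonClass α] {μ : Measure α} [IsProbabilityMeasure μ]
    {c : α → List Bool} (hc : IsOptimalCode μ c) :
    expectedLength μ c ≤ entropy μ + 1 := by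
  refine hc.expectedLength_le.trans (le_of_eq ?_)
  rw [entropy_eq, ← tsum_measure_singleton_eq_one μ, ← ENNReal.tsum_add]
  refine tsum_congr fun a => ?_
  rw [ENNReal.ofReal_add (logb_one_div_measureReal_nonneg _ _) zero_le_one, mul_add]
  simp

/-- The bound `log₂ M + log₂ e + 1` on the expected length of the description of an index selected
by rejection sampling with ceiling `M`. -/
def indexBound (M : ℝ) : ℝ := Real.logb 2 M + Real.logb 2 (Real.exp 1) + 1

lemma coe_successProb {M : ℝ} (hM : 1 ≤ M) : (successProb M : ℝ) = 1 / M := by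
  have h0 : 0 < M := by linarith
  rw [successProb, Set.projIcc_of_mem zero_le_one ⟨by positivity, by
    rw [div_le_one h0]; exact hM⟩]

lemma indexLaw_singleton {M : ℝ} (hM : 1 ≤ M) (k : ℕ) :
    indexLaw M {k} = ENNReal.ofReal ((1 - 1 / M) ^ k * (1 / M)) := by
  have h0 : 0 < M := by linarith
  have hne : successProb M ≠ 0 := by
    intro h
    have := coe_successProb hM
    rw [h] at this
    simp at this
    linarith
  rw [indexLaw, geometricMeasure_singleton hne, coe_successProb hM]

/-- An optimal code for the geometric law with success probability `1 / M` uses at most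
`log₂ M + log₂ e + 1` bits on average. With `q = 1 - 1 / M`, the entropy of that law is
`log₂ M + (M - 1) log₂ (1 / q)`, and `(M - 1) log (1 / q) ≤ (M - 1) (1 / q - 1) = 1`. -/
lemma expectedLength_indexLaw_le {M : ℝ} (hM : 1 ≤ M) {c : ℕ → List Bool}
    (hc : IsOptimalCode (indexLaw M) c) :
    expectedLength (indexLaw M) c ≤ ENNReal.ofReal (indexBound M) := by
  have h0 : 0 < M := by linarith
  have hle : 0 ≤ Real.logb 2 (Real.exp 1) := by
    refine Real.logb_nonneg (by norm_num) ?_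
    exact Real.one_le_exp zero_le_one
  have hlM : 0 ≤ Real.logb 2 M := Real.logb_nonneg (by norm_num) hM
  refine hc.expectedLength_le.trans ?_
  have hlog2 : 0 < Real.log 2 := Real.log_pos (by norm_num)
  -- for `M = 1` the law is a point mass, and `log₂ (1 / q)` would be a junk value
  rcases eq_or_lt_of_le hM with rfl | hM1
  · rw [tsum_eq_single 0]
    · have : (indexLaw 1).real {0} = 1 := by
        rw [Measure.real, indexLaw_singleton le_rfl]; simp
      rw [this, indexLaw_singleton le_rfl]
      simp [indexBound, hle]
    · intro k hk
      rw [indexLaw_singleton le_rfl]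
      simp [hk]
  set q : ℝ := 1 - 1 / M with hq
  have hq0 : 0 < q := by
    rw [hq, sub_pos, div_lt_one h0]; exact hM1
  have hq1 : q < 1 := by
    have : 0 < 1 / M := by positivity
    linarith
  have hMq : M * (1 - q) = 1 := by rw [hq]; field_simp; ring
  set L : ℝ := Real.logb 2 (1 / q) with hL
  have hterm : ∀ k : ℕ, (indexLaw M) {k} *
      ENNReal.ofReal (Real.logb 2 (1 / (indexLaw M).real {k}) + 1) =
      ENNReal.ofReal ((Real.logb 2 M + 1) * (1 / M) * q ^ k + L * (1 / M) * (k * q ^ k)) := by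
    intro k
    have hr : (indexLaw M).real {k} = q ^ k * (1 / M) := by
      rw [Measure.real, indexLaw_singleton hM, ENNReal.toReal_ofReal (by positivity)]
    rw [hr, indexLaw_singleton hM, ← ENNReal.ofReal_mul (by positivity)]
    congr 1
    have : Real.logb 2 (1 / (q ^ k * (1 / M))) = Real.logb 2 M + k * L := by
      have h1 : 1 / (q ^ k * (1 / M)) = M * (1 / q) ^ k := by
        rw [one_div_pow]
        field_simp
      rw [h1, Real.logb_mul h0.ne' (by positivity), Real.logb_pow]
    rw [this]
    ring
  have hs1 : HasSum (fun k : ℕ => q ^ k) (1 - q)⁻¹ := hasSum_geometric_of_lt_one hq0.le hq1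
  have hs2 : HasSum (fun k : ℕ => (k : ℝ) * q ^ k) (q / (1 - q) ^ 2) :=
    hasSum_coe_mul_geometric_of_norm_lt_one (by rwa [Real.norm_of_nonneg hq0.le])
  have hs := (hs1.mul_left ((Real.logb 2 M + 1) * (1 / M))).add (hs2.mul_left (L * (1 / M)))
  have hL0 : 0 ≤ L := Real.logb_nonneg (by norm_num) (by rw [le_div_iff₀ hq0]; linarith)
  rw [tsum_congr hterm, ← ENNReal.ofReal_tsum_of_nonneg _ hs.summable, hs.tsum_eq]
  · refine ENNReal.ofReal_le_ofReal ?_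
    have hinv : (1 - q)⁻¹ = M := by
      rw [inv_eq_iff_eq_inv]; field_simp; linarith
    have e1 : (Real.logb 2 M + 1) * (1 / M) * (1 - q)⁻¹ = Real.logb 2 M + 1 := by
      rw [hinv]; field_simp
    have e2 : L * (1 / M) * (q / (1 - q) ^ 2) = L * (M * q) := by
      rw [div_eq_mul_inv q, ← inv_pow, hinv]; field_simp
    rw [e1, e2, indexBound]
    have h3 : L * (M * q) ≤ Real.logb 2 (Real.exp 1) := by
      rw [hL, Real.logb, Real.logb, Real.log_exp, div_mul_eq_mul_div]
      refine div_le_div_of_nonneg_right ?_ hlog2.le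
      have h4 := Real.log_le_sub_one_of_pos (x := 1 / q) (by positivity)
      have h5 : (1 / q - 1) * (M * q) = 1 := by
        field_simp; linarith
      calc Real.log (1 / q) * (M * q) ≤ (1 / q - 1) * (M * q) :=
            mul_le_mul_of_nonneg_right h4 (by positivity)
        _ = 1 := h5
    linarith
  · intro k
    positivity

/-! ### Exactness of the two samplers -/

lemma measurable_sInf_nat {Z : Type*} [MeasurableSpace Z] {p : Z → Set ℕ}
    (h : ∀ k, MeasurableSet {z | k ∈ p z}) : Measurable fun z => sInf (p z) := by
  refine measurable_to_countable' fun k => ?_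
  have : (fun z => sInf (p z)) ⁻¹' {k} =
      ({z | k ∈ p z} ∩ ⋂ j < k, {z | j ∈ p z}ᶜ) ∪ {z | k = 0 ∧ ∀ j, j ∉ p z} := by
    ext z
    simp only [Set.mem_preimage, Set.mem_singleton_iff, Set.mem_union, Set.mem_inter_iff,
      Set.mem_ofPred_eq, Set.mem_iInter, Set.mem_compl_iff]
    constructor
    · rintro rfl
      by_cases hne : (p z).Nonempty
      · exact Or.inl ⟨Nat.sInf_mem hne, fun j hj => Nat.notMem_of_lt_sInf hj⟩
      · rw [Set.not_nonempty_iff_eq_empty] at hne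
        right; simp [hne]
    · rintro (⟨h1, h2⟩ | ⟨rfl, h2⟩)
      · exact le_antisymm (Nat.sInf_le h1)
          (le_csInf ⟨_, h1⟩ fun j hj => not_lt.1 fun hjk => h2 j hjk hj)
      · have : p z = ∅ := Set.eq_empty_iff_forall_notMem.2 h2
        simp [this]
  rw [this]
  refine ((h k).inter (MeasurableSet.biInter (Set.to_countable _) fun j _ => (h j).compl)).union ?_
  by_cases hk : k = 0
  · simp only [hk, true_and, Set.ofPred_forall]
    exact MeasurableSet.iInter fun j => (h j).compl
  · simp [hk]

lemma sInf_eq_of_mem {s : Set ℕ} {k : ℕ} (hk : k ∈ s) (h : ∀ j < k, j ∉ s) : sInf s = k :=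
  le_antisymm (Nat.sInf_le hk) (le_csInf ⟨_, hk⟩ fun j hj => not_lt.1 fun hjk => h j hjk hj)

lemma measure_le_of_singleton_le {α : Type*} [Countable α] [MeasurableSpace α]
    [MeasurableSingletonClass α] {μ ν : Measure α} (h : ∀ a, μ {a} ≤ ν {a}) : μ ≤ ν := by
  rw [Measure.le_iff]
  intro s _
  rw [← Set.biUnion_of_singleton s, measure_biUnion (Set.to_countable s)
    (fun a _ b _ hab => by simpa using hab) (fun _ _ => measurableSet_singleton _),
    measure_biUnion (Set.to_countable s)
    (fun a _ b _ hab => by simpa using hab) (fun _ _ => measurableSet_singleton _)]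
  exact ENNReal.tsum_le_tsum fun a => h a

lemma measurable_sample_kernel {𝒳 α : Type*} [MeasurableSpace 𝒳] [Denumerable α]
    [MeasurableSpace α] [MeasurableSingletonClass α] (q : Kernel 𝒳 α) :
    Measurable fun p : 𝒳 × unitInterval => sample (q p.1) p.2 := by
  refine (measurable_from_nat (f := Denumerable.ofNat α)).comp
    (measurable_sInf_nat fun k => ?_)
  refine measurableSet_lt (measurable_subtype_coe.comp measurable_snd) ?_
  refine Finset.measurable_fun_sum _ fun i _ => ?_
  exact ((q.measurable_coe (measurableSet_singleton _)).comp measurable_fst).ennreal_toReal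

lemma measurable_sample {α : Type*} [Denumerable α] [MeasurableSpace α]
    [MeasurableSingletonClass α] (q : Measure α) : Measurable (sample q) :=
  (measurable_sample_kernel (Kernel.const Unit q)).comp (measurable_prodMk_left (x := ()))

/-- Inverse-transform sampling has the prescribed law. -/
lemma map_sample {α : Type*} [Denumerable α] [MeasurableSpace α] [MeasurableSingletonClass α]
    (q : Measure α) [IsProbabilityMeasure q] :
    (volume : Measure unitInterval).map (sample q) = q := by
  have hm := measurable_sample q
  have hprob : IsProbabilityMeasure ((volume : Measure unitInterval).map (sample q)) :=
    Measure.isProbabilityMeasure_map hm.aemeasurable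
  symm
  refine Measure.eq_of_le_of_measure_univ_eq (measure_le_of_singleton_le fun a => ?_) (by simp)
  rw [Measure.map_apply hm (measurableSet_singleton _)]
  obtain ⟨n, hn⟩ : ∃ n, Denumerable.ofNat α n = a := ⟨Encodable.encode a, by simp⟩
  set F : ℕ → ℝ := fun n => ∑ i ∈ Finset.range n, q.real {Denumerable.ofNat α i} with hF
  have hF0 : ∀ n, 0 ≤ F n := fun n => Finset.sum_nonneg fun _ _ => measureReal_nonneg
  have hFmono : Monotone F := fun n m h =>
    Finset.sum_le_sum_of_subset_of_nonneg (Finset.range_subset_range.2 h)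
      fun _ _ _ => measureReal_nonneg
  have hF1 : ∀ n, F n ≤ 1 := by
    intro n
    rw [hF]
    simp only
    rw [← measureReal_biUnion_finset (fun i _ j _ hij => by
      simp only [Function.onFun, Set.disjoint_singleton]
      intro h
      exact hij (by simpa using congrArg Encodable.encode h))
      (fun _ _ => measurableSet_singleton _)]
    exact measureReal_le_one
  -- the `n`-th symbol is selected when `v` falls between two consecutive partial sums; an inclusion
  -- suffices, both sides being probability measures
  have hsub : Set.Ico (⟨F n, hF0 n, hF1 n⟩ : unitInterval) ⟨F (n + 1), hF0 _, hF1 _⟩ ⊆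
      sample q ⁻¹' {a} := by
    rintro v ⟨hv1, hv2⟩
    have hv1' : F n ≤ (v : ℝ) := hv1
    have hv2' : (v : ℝ) < F (n + 1) := hv2
    have : sInf {k : ℕ | (v : ℝ) < F (k + 1)} = n := by
      refine sInf_eq_of_mem hv2' fun j hj hlt => ?_
      have h3 : (v : ℝ) < F (j + 1) := hlt
      exact absurd (h3.trans_le (hFmono (Nat.succ_le_of_lt hj))) (not_lt.2 hv1')
    change Denumerable.ofNat α (sInf {k : ℕ | (v : ℝ) < F (k + 1)}) = a
    rw [this, hn]
  refine le_trans (le_of_eq ?_) (measure_mono hsub)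
  rw [unitInterval.volume_Ico]
  simp only [hF, Finset.sum_range_succ, add_sub_cancel_left]
  rw [hn, ofReal_measureReal]

lemma volume_ofReal_le (s : ℝ≥0∞) :
    (volume : Measure unitInterval) {v | ENNReal.ofReal v ≤ s} = min s 1 := by
  rcases le_total 1 s with h | h
  · rw [min_eq_right h]
    have : {v : unitInterval | ENNReal.ofReal v ≤ s} = Set.univ :=
      Set.eq_univ_of_forall fun v => (ENNReal.ofReal_le_one.2 v.2.2).trans h
    rw [this, measure_univ]
  · have hs : s ≠ ⊤ := ne_top_of_le_ne_top ENNReal.one_ne_top h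
    have h1 : s.toReal ≤ 1 := by simpa using ENNReal.toReal_mono ENNReal.one_ne_top h
    have : {v : unitInterval | ENNReal.ofReal v ≤ s} =
        Set.Iic ⟨s.toReal, ENNReal.toReal_nonneg, h1⟩ := by
      ext v
      rw [Set.mem_Iic, ← Subtype.coe_le_coe, Set.mem_ofPred_eq,
        ENNReal.ofReal_le_iff_le_toReal hs]
    rw [this, unitInterval.volume_Iic, min_eq_left h, ENNReal.ofReal_toReal hs]

lemma measurable_rejectionIndex {Z α : Type*} [MeasurableSpace Z] [MeasurableSpace α]
    {M : Z → ℝ} {r : Z → α → ℝ≥0∞} {c : Z → ℕ → α} {v : Z → ℕ → unitInterval}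
    (hM : Measurable M) (hr : Measurable fun p : Z × α => r p.1 p.2) (hc : Measurable c)
    (hv : Measurable v) :
    Measurable fun z => rejectionIndex (M z) (r z) (c z) (v z) := by
  refine measurable_sInf_nat fun k => ?_
  change MeasurableSet {z | ENNReal.ofReal (v z k) ≤ r z (c z k) / ENNReal.ofReal (M z)}
  refine measurableSet_le ?_ ?_
  · exact (measurable_subtype_coe.comp ((measurable_pi_apply k).comp hv)).ennreal_ofReal
  · exact (hr.comp (measurable_id.prodMk ((measurable_pi_apply k).comp hc))).div hM.ennreal_ofReal

/-- Rejection sampling is exact: if the target `ν` has density `r ≤ M` with respect to the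
proposal `Q`, the selected entry has law `ν`, the selected index is geometric with success
probability `1 / M`, and the two are independent. -/
theorem map_rejectionIndex {α : Type*} [MeasurableSpace α] {Q ν : Measure α}
    [IsProbabilityMeasure Q] [IsProbabilityMeasure ν] {M : ℝ} {r : α → ℝ≥0∞} (hr : Measurable r)
    (hν : Q.withDensity r = ν) (hrM : ∀ᵐ a ∂Q, r a ≤ ENNReal.ofReal M) (hM : 1 ≤ M) :
    ((Measure.infinitePi fun _ : ℕ => Q).prod
      (Measure.infinitePi fun _ : ℕ => (volume : Measure unitInterval))).map
        (fun p => (rejectionIndex M r p.1 p.2, p.1 (rejectionIndex M r p.1 p.2))) =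
      (indexLaw M).prod ν := by
  classical
  have h0 : 0 < M := by linarith
  set m := ENNReal.ofReal M with hm
  have hm0 : m ≠ 0 := by simpa [hm] using h0
  set U : Measure (ℕ → unitInterval) := Measure.infinitePi fun _ => volume with hU
  set K : (ℕ → α) × (ℕ → unitInterval) → ℕ := fun p => rejectionIndex M r p.1 p.2 with hK
  have hKm : Measurable K := measurable_rejectionIndex (M := fun _ => M) (r := fun _ => r)
    (c := fun p : (ℕ → α) × (ℕ → unitInterval) => p.1) (v := fun p => p.2) measurable_const
    (hr.comp measurable_snd) measurable_fst measurable_snd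
  have hev : Measurable fun p : (ℕ → α) × ℕ => p.1 p.2 :=
    measurable_from_prod_countable_left fun k => measurable_pi_apply k
  have hφ : Measurable fun p : (ℕ → α) × (ℕ → unitInterval) => (K p, p.1 (K p)) :=
    hKm.prodMk (hev.comp (measurable_fst.prodMk hKm))
  -- `acc i` is the event that the `i`-th sample is accepted
  let acc : ℕ → Set ((ℕ → α) × (ℕ → unitInterval)) :=
    fun i => {p | ENNReal.ofReal (p.2 i) ≤ r (p.1 i) / m}
  have hacc : ∀ i, MeasurableSet (acc i) := fun i => measurableSet_le
    (measurable_subtype_coe.comp ((measurable_pi_apply i).comp measurable_snd)).ennreal_ofReal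
    ((hr.comp ((measurable_pi_apply i).comp measurable_fst)).div_const _)
  -- `E k A` is the event that `k` is the first accepted index and its sample lies in `A`
  let E : ℕ → Set α → Set ((ℕ → α) × (ℕ → unitInterval)) := fun k A =>
    (⋂ i < k, (acc i)ᶜ) ∩ acc k ∩ {p | p.1 k ∈ A}
  have hEm : ∀ k A, MeasurableSet A → MeasurableSet (E k A) := fun k A hA =>
    ((MeasurableSet.biInter (Set.to_countable _) fun i _ => (hacc i).compl).inter (hacc k)).inter
      (((measurable_pi_apply k).comp measurable_fst) hA)
  have hEK : ∀ k A p, p ∈ E k A → K p = k := by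
    rintro k A p ⟨⟨h1, h2⟩, -⟩
    refine sInf_eq_of_mem h2 fun j hj => ?_
    simp only [Set.mem_iInter] at h1
    exact h1 j hj
  -- `ρ a` is the probability that a sample with value `a` is accepted
  let ρ : α → ℝ≥0∞ := fun a => min (r a / m) 1
  have hρm : Measurable ρ := (hr.div_const _).min measurable_const
  have hρ : ∀ A, MeasurableSet A → ∫⁻ a in A, ρ a ∂Q = ν A / m := by
    intro A hA
    have : ∀ᵐ a ∂(Q.restrict A), ρ a = r a / m := by
      filter_upwards [ae_restrict_of_ae hrM] with a ha
      exact min_eq_left (ENNReal.div_le_of_le_mul (by simpa using ha))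
    rw [lintegral_congr_ae this, ← hν, withDensity_apply _ hA]
    simp only [div_eq_mul_inv]
    rw [lintegral_mul_const _ hr]
  have hmass : ∀ k A, MeasurableSet A →
      (Measure.infinitePi fun _ : ℕ => Q).prod U (E k A) = indexLaw M {k} * ν A := by
    intro k A hA
    let f : ℕ → α → ℝ≥0∞ := fun i => if i < k then fun a => 1 - ρ a else A.indicator ρ
    have hf : ∀ i, Measurable (f i) := by
      intro i
      simp only [f]
      split_ifs
      · exact measurable_const.sub hρm
      · exact hρm.indicator hA
    -- for a given codebook the acceptance events are independent
    have hsec : ∀ c : ℕ → α, U (Prod.mk c ⁻¹' E k A) =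
        ∏ i ∈ Finset.range (k + 1), f i (c i) := by
      intro c
      rw [Finset.prod_range_succ]
      by_cases hcA : c k ∈ A
      · let t : ℕ → Set unitInterval := fun i =>
          if i < k then {v | ENNReal.ofReal v ≤ r (c i) / m}ᶜ
          else {v | ENNReal.ofReal v ≤ r (c i) / m}
        have hset : ∀ i, MeasurableSet {v : unitInterval | ENNReal.ofReal v ≤ r (c i) / m} :=
          fun i => measurableSet_le measurable_subtype_coe.ennreal_ofReal measurable_const
        have hpi : Prod.mk c ⁻¹' E k A = Set.pi (Finset.range (k + 1) : Finset ℕ) t := by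
          ext v
          simp only [E, acc, t, Set.mem_preimage, Set.mem_inter_iff, Set.mem_iInter,
            Set.mem_compl_iff, Set.mem_ofPred_eq, hcA, and_true, Set.mem_pi, Finset.coe_range,
            Set.mem_Iio, Nat.lt_succ_iff_lt_or_eq]
          constructor
          · rintro ⟨h1, h2⟩ i (hi | rfl)
            · simpa [hi] using h1 i hi
            · simpa using h2
          · intro h
            refine ⟨fun i hi => ?_, ?_⟩
            · simpa [hi] using h i (Or.inl hi)
            · simpa using h k (Or.inr rfl)
        rw [hpi, hU, Measure.infinitePi_pi _ (fun i _ => by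
          simp only [t]; split_ifs; exacts [(hset i).compl, hset i]), Finset.prod_range_succ]
        congr 1
        · refine Finset.prod_congr rfl fun i hi => ?_
          have hi' := Finset.mem_range.1 hi
          simp only [t, f, hi', if_true]
          rw [prob_compl_eq_one_sub (hset i), volume_ofReal_le]
        · simp only [t, f, lt_irrefl, if_false, Set.indicator_of_mem hcA]
          rw [volume_ofReal_le]
      · have : Prod.mk c ⁻¹' E k A = ∅ := by
          ext v; simp [E, hcA]
        rw [this]
        simp [f, hcA]
    have hind : iIndepFun (fun i (c : ℕ → α) => f i (c i)) (Measure.infinitePi fun _ : ℕ => Q) :=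
      iIndepFun_infinitePi hf
    have hint : ∀ i, ∫⁻ c, f i (c i) ∂(Measure.infinitePi fun _ : ℕ => Q) = ∫⁻ a, f i a ∂Q :=
      fun i => (measurePreserving_eval_infinitePi (fun _ : ℕ => Q) i).lintegral_comp (hf i)
    rw [Measure.prod_apply (hEm k A hA), lintegral_congr hsec,
      lintegral_prod_eq_prod_lintegral_of_indepFun _ _ hind
        (fun i => (hf i).comp (measurable_pi_apply i)), Finset.prod_range_succ]
    simp only [hint]
    have hk : ∫⁻ a, f k a ∂Q = ν A / m := by
      simp only [f, lt_irrefl, if_false]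
      rw [lintegral_indicator hA, hρ A hA]
    have hi : ∀ i ∈ Finset.range k, ∫⁻ a, f i a ∂Q = 1 - 1 / m := by
      intro i hi
      simp only [f, Finset.mem_range.1 hi, if_true]
      have huniv := hρ Set.univ MeasurableSet.univ
      rw [Measure.restrict_univ, measure_univ] at huniv
      rw [lintegral_sub hρm (by rw [huniv]; exact ENNReal.div_ne_top (by simp) hm0)
        (Filter.Eventually.of_forall fun a => min_le_right _ _), huniv]
      simp
    rw [Finset.prod_congr rfl hi, hk, Finset.prod_const, Finset.card_range, indexLaw_singleton hM]
    have hMle : 1 / M ≤ 1 := by rw [div_le_one h0]; exact hM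
    rw [ENNReal.ofReal_mul (by have := sub_nonneg.2 hMle; positivity),
      ENNReal.ofReal_pow (sub_nonneg.2 hMle), ENNReal.ofReal_sub _ (by positivity),
      ENNReal.ofReal_div_of_pos h0, ENNReal.ofReal_one, mul_assoc]
    congr 1
    rw [div_eq_mul_inv, div_eq_mul_inv, one_mul, mul_comm]
  have hprob : IsProbabilityMeasure (((Measure.infinitePi fun _ : ℕ => Q).prod U).map
      (fun p => (K p, p.1 (K p)))) := Measure.isProbabilityMeasure_map hφ.aemeasurable
  -- both sides are probability measures, so one inequality suffices
  symm
  refine Measure.eq_of_le_of_measure_univ_eq ?_ (by simp)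
  rw [Measure.le_iff]
  intro S hS
  rw [Measure.map_apply hφ hS, Measure.prod_apply hS, lintegral_countable']
  have hSk : ∀ k : ℕ, MeasurableSet (Prod.mk k ⁻¹' S) := fun k => measurable_prodMk_left hS
  have hsum : ∑' k, ν (Prod.mk k ⁻¹' S) * indexLaw M {k} =
      (Measure.infinitePi fun _ : ℕ => Q).prod U (⋃ k, E k (Prod.mk k ⁻¹' S)) := by
    rw [measure_iUnion (fun i j hij => ?_) (fun k => hEm k _ (hSk k))]
    · exact tsum_congr fun k => by rw [hmass k _ (hSk k), mul_comm]
    · rw [Function.onFun, Set.disjoint_left]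
      intro p hp hp'
      exact hij ((hEK _ _ _ hp).symm.trans (hEK _ _ _ hp'))
  rw [hsum]
  refine measure_mono ?_
  intro p hp
  rw [Set.mem_iUnion] at hp
  obtain ⟨k, hk⟩ := hp
  rw [Set.mem_preimage, hEK _ _ _ hk]
  exact hk.2

/-- A ceiling that dominates the ratio of two probability measures is at least one. -/
lemma one_le_of_le_smul {α : Type*} [MeasurableSpace α] {Q ν : Measure α}
    [IsProbabilityMeasure Q] [IsProbabilityMeasure ν] {M : ℝ}
    (hle : ν ≤ ENNReal.ofReal M • Q) : 1 ≤ M := by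
  have := hle Set.univ
  simpa using this

/-- A form of `map_rejectionIndex` in which the density bound is expressed by domination of
measures, and indices of probability zero are replaced. -/
theorem lintegral_rejection {α : Type*} [MeasurableSpace α] {Q ν : Measure α}
    [IsProbabilityMeasure Q] [IsProbabilityMeasure ν] {M : ℝ} {r : α → ℝ≥0∞} (hr : Measurable r)
    (hrν : r =ᵐ[Q] ν.rnDeriv Q) (hle : ν ≤ ENNReal.ofReal M • Q)
    {F : ℕ → α → ℝ≥0∞} (hF : ∀ k, Measurable (F k)) :
      ∫⁻ c, ∫⁻ v, F (toAtom (indexLaw M) (rejectionIndex M r c v))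
          (c (toAtom (indexLaw M) (rejectionIndex M r c v)))
          ∂(Measure.infinitePi fun _ : ℕ => (volume : Measure unitInterval))
          ∂(Measure.infinitePi fun _ : ℕ => Q) =
        ∫⁻ k, ∫⁻ a, F k a ∂ν ∂(indexLaw M) := by
  have hM : 1 ≤ M := one_le_of_le_smul hle
  have hac : ν ≪ Q := Measure.absolutelyContinuous_of_le_smul hle
  have hν : Q.withDensity r = ν := by
    rw [withDensity_congr_ae hrν, Measure.withDensity_rnDeriv_eq _ _ hac]
  have hrM : ∀ᵐ a ∂Q, r a ≤ ENNReal.ofReal M := by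
    refine ae_le_of_forall_setLIntegral_le_of_sigmaFinite hr (f := r) fun s hs _ => ?_
    rw [← withDensity_apply _ hs, hν, setLIntegral_const]
    exact hle s
  have hmap := map_rejectionIndex hr hν hrM hM
  have hFm : Measurable fun p : ℕ × α => F p.1 p.2 := measurable_from_prod_countable_right hF
  have hKm : Measurable fun p : (ℕ → α) × (ℕ → unitInterval) => rejectionIndex M r p.1 p.2 :=
    measurable_rejectionIndex (M := fun _ => M) (r := fun _ => r)
    (c := fun p : (ℕ → α) × (ℕ → unitInterval) => p.1) (v := fun p => p.2) measurable_const
    (hr.comp measurable_snd) measurable_fst measurable_snd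
  have hev : Measurable fun p : (ℕ → α) × ℕ => p.1 p.2 :=
    measurable_from_prod_countable_left fun k => measurable_pi_apply k
  have hφ : Measurable fun p : (ℕ → α) × (ℕ → unitInterval) =>
      (rejectionIndex M r p.1 p.2, p.1 (rejectionIndex M r p.1 p.2)) :=
    hKm.prodMk (hev.comp (measurable_fst.prodMk hKm))
  -- the index is almost surely one of positive probability, so `toAtom` does not change it
  have hatom : ∀ᵐ p ∂((Measure.infinitePi fun _ : ℕ => Q).prod
      (Measure.infinitePi fun _ : ℕ => (volume : Measure unitInterval))),
      rejectionIndex M r p.1 p.2 ∈ atoms (indexLaw M) := by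
    have h1 : ∀ᵐ z ∂((indexLaw M).prod ν), z.1 ∈ atoms (indexLaw M) := by
      have h2 : ∀ᵐ k ∂(indexLaw M), k ∈ atoms (indexLaw M) := by
        rw [ae_iff_of_countable]
        exact fun k hk => hk
      exact Measure.quasiMeasurePreserving_fst.ae h2
    rw [← hmap] at h1
    exact ae_of_ae_map hφ.aemeasurable h1
  have hKa : Measurable fun p : (ℕ → α) × (ℕ → unitInterval) =>
      toAtom (indexLaw M) (rejectionIndex M r p.1 p.2) :=
    (measurable_from_nat (f := toAtom (indexLaw M))).comp hKm
  rw [lintegral_lintegral (f := fun c v => F (toAtom (indexLaw M) (rejectionIndex M r c v))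
          (c (toAtom (indexLaw M) (rejectionIndex M r c v))))
      (hFm.comp (hKa.prodMk (hev.comp (measurable_fst.prodMk hKa)))).aemeasurable]
  rw [lintegral_lintegral (f := F) hFm.aemeasurable, ← hmap,
    lintegral_map hFm hφ]
  refine lintegral_congr_ae ?_
  filter_upwards [hatom] with p hp
  have : toAtom (indexLaw M) (rejectionIndex M r p.1 p.2) = rejectionIndex M r p.1 p.2 := by
    rw [toAtom, if_pos hp]
  rw [this]

/-! ### Conditional laws given the input -/

section Conditioning

variable {𝒳 𝒴 Ω B : Type*} [MeasurableSpace 𝒳] [MeasurableSpace 𝒴] [MeasurableSpace Ω]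
  [MeasurableSpace B]

/-- The conditional law of `F (X, Y)` given `X = x`, where `Y ∼ κ x`. -/
def imageKernel (κ : Kernel 𝒳 𝒴) (F : 𝒳 × 𝒴 → Ω) : Kernel 𝒳 Ω := (Kernel.id ×ₖ κ).map F

lemma imageKernel_apply (κ : Kernel 𝒳 𝒴) [IsMarkovKernel κ] {F : 𝒳 × 𝒴 → Ω} (hF : Measurable F)
    (x : 𝒳) : imageKernel κ F x = (κ x).map fun y => F (x, y) := by
  rw [imageKernel, Kernel.map_apply _ hF, Kernel.prod_apply, Kernel.id_apply, Measure.dirac_prod,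
    Measure.map_map hF measurable_prodMk_left]
  rfl

lemma isMarkovKernel_imageKernel (κ : Kernel 𝒳 𝒴) [IsMarkovKernel κ] {F : 𝒳 × 𝒴 → Ω}
    (hF : Measurable F) : IsMarkovKernel (imageKernel κ F) :=
  Kernel.IsMarkovKernel.map _ hF

lemma map_graph_eq_compProd (P : Measure 𝒳) [IsProbabilityMeasure P] (κ : Kernel 𝒳 𝒴)
    [IsMarkovKernel κ] {F : 𝒳 × 𝒴 → Ω} (hF : Measurable F) :
    (P ⊗ₘ κ).map (fun z => (z.1, F z)) = P ⊗ₘ imageKernel κ F := by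
  have := isMarkovKernel_imageKernel κ hF
  have hm : Measurable fun z : 𝒳 × 𝒴 => (z.1, F z) := measurable_fst.prodMk hF
  ext S hS
  rw [Measure.map_apply hm hS, Measure.compProd_apply (hm hS), Measure.compProd_apply hS]
  refine lintegral_congr fun x => ?_
  have hFx : Measurable fun y => F (x, y) := hF.comp measurable_prodMk_left
  rw [imageKernel_apply κ hF, Measure.map_apply hFx (measurable_prodMk_left hS)]
  rfl

lemma map_fst_compProd (P : Measure 𝒳) [IsProbabilityMeasure P] (κ : Kernel 𝒳 𝒴)
    [IsMarkovKernel κ] : (P ⊗ₘ κ).map Prod.fst = P :=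
  Measure.fst_compProd P κ

/-- For almost every input `x`, the conditional law of `F (X, Y)` given `X = x` is the law of
`F (x, Y)` with `Y ∼ κ x`. -/
lemma condDistrib_fst_ae [StandardBorelSpace Ω] [Nonempty Ω] (P : Measure 𝒳)
    [IsProbabilityMeasure P] (κ : Kernel 𝒳 𝒴) [IsMarkovKernel κ] {F : 𝒳 × 𝒴 → Ω}
    (hF : Measurable F) :
    ∀ᵐ x ∂P, condDistrib F Prod.fst (P ⊗ₘ κ) x = (κ x).map fun y => F (x, y) := by
  have := isMarkovKernel_imageKernel κ hF
  have h := condDistrib_ae_eq_of_measure_eq_compProd_of_measurable (μ := P ⊗ₘ κ)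
    (κ := imageKernel κ F) measurable_fst hF
    (by rw [map_fst_compProd]; exact map_graph_eq_compProd P κ hF)
  rw [map_fst_compProd] at h
  filter_upwards [h] with x hx
  rw [hx, imageKernel_apply κ hF]

/-- For almost every input `x`, conditioning on `X = x` and on a discrete variable `F` amounts to
elementary conditioning of `κ x` on a level set of `F (x, ·)`. -/
lemma condDistrib_pair_ae [StandardBorelSpace Ω] [Nonempty Ω] [StandardBorelSpace B]
    [Countable B] (P : Measure 𝒳) [IsProbabilityMeasure P]
    (κ : Kernel 𝒳 𝒴) [IsMarkovKernel κ] {F : 𝒳 × 𝒴 → B} (hF : Measurable F)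
    {G : 𝒳 × 𝒴 → Ω} (hG : Measurable G) :
    ∀ᵐ x ∂P, ∀ b, κ x {y | F (x, y) = b} ≠ 0 →
      condDistrib G (fun z => (z.1, F z)) (P ⊗ₘ κ) (x, b) =
        (cond (κ x) {y | F (x, y) = b}).map fun y => G (x, y) := by
  have h1 := isMarkovKernel_imageKernel κ hF
  have hFG : Measurable fun z => (F z, G z) := hF.prodMk hG
  have h2 := isMarkovKernel_imageKernel κ hFG
  set c := condDistrib G (fun z => (z.1, F z)) (P ⊗ₘ κ) with hc
  have hX : Measurable fun z : 𝒳 × 𝒴 => (z.1, F z) := measurable_fst.prodMk hF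
  -- both kernels disintegrate the joint law of `(X, F, G)`
  have hjoint : P ⊗ₘ (imageKernel κ F ⊗ₖ c) = P ⊗ₘ imageKernel κ (fun z => (F z, G z)) := by
    have h3 : (P ⊗ₘ imageKernel κ F) ⊗ₘ c =
        (P ⊗ₘ κ).map fun z => ((z.1, F z), G z) := by
      rw [← map_graph_eq_compProd P κ hF, hc, compProd_map_condDistrib hG.aemeasurable]
    rw [← Measure.compProd_assoc', h3, ← map_graph_eq_compProd P κ hFG,
      Measure.map_map (MeasurableEquiv.measurable _) (hX.prodMk hG)]
    rfl
  have hae := Kernel.ae_eq_of_compProd_eq hjoint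
  filter_upwards [hae] with x hx b hb
  have hFx : Measurable fun y => F (x, y) := hF.comp measurable_prodMk_left
  have hGx : Measurable fun y => G (x, y) := hG.comp measurable_prodMk_left
  have hbm : MeasurableSet {y | F (x, y) = b} := hFx (measurableSet_singleton b)
  ext A hA
  have h4 : (imageKernel κ F ⊗ₖ c) x ({b} ×ˢ A) =
      imageKernel κ (fun z => (F z, G z)) x ({b} ×ˢ A) := by rw [hx]
  have h5 : MeasurableSet (({b} : Set B) ×ˢ A) := (measurableSet_singleton b).prod hA
  rw [imageKernel_apply κ hFG, Measure.map_apply (hFx.prodMk hGx) h5,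
    Kernel.compProd_apply_prod (measurableSet_singleton b) hA,
    lintegral_singleton, imageKernel_apply κ hF, Measure.map_apply hFx (measurableSet_singleton b)]
    at h4
  rw [Measure.map_apply hGx hA, cond_apply hbm]
  have h6 : c (x, b) A = (κ x {y | F (x, y) = b})⁻¹ * (c (x, b) A * κ x {y | F (x, y) = b}) := by
    rw [mul_comm (c (x, b) A), ← mul_assoc, ENNReal.inv_mul_cancel hb (measure_ne_top _ _), one_mul]
  rw [h6]
  exact congrArg _ h4

/-- Values of a discrete variable that have probability zero have conditional probability zero for
almost every input. -/
lemma ae_measure_eq_zero_of_map {P : Measure 𝒳} [IsProbabilityMeasure P] {κ : Kernel 𝒳 𝒴}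
    [IsMarkovKernel κ] [Countable B] [MeasurableSingletonClass B] {F : 𝒳 × 𝒴 → B}
    (hF : Measurable F) :
    ∀ᵐ x ∂P, ∀ b, (P ⊗ₘ κ).map F {b} = 0 → κ x {y | F (x, y) = b} = 0 := by
  rw [ae_all_iff]
  intro b
  by_cases hb : (P ⊗ₘ κ).map F {b} = 0
  · have hb' := hb
    rw [Measure.map_apply hF (measurableSet_singleton b),
      Measure.compProd_apply (hF (measurableSet_singleton b)), lintegral_eq_zero_iff
        (Kernel.measurable_kernel_prodMk_left (hF (measurableSet_singleton b)))] at hb'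
    filter_upwards [hb'] with x hx _
    exact hx
  · exact Filter.Eventually.of_forall fun x h => absurd h hb

end Conditioning

section Scheme

set_option linter.unusedSectionVars false

variable {𝒳 𝒴 : Type*} [MeasurableSpace 𝒳] [StandardBorelSpace 𝒳]
  [MeasurableSpace 𝒴] [StandardBorelSpace 𝒴] [Nonempty 𝒴]
  (P : Measure 𝒳) [IsProbabilityMeasure P] (κ : Kernel 𝒳 𝒴) [IsMarkovKernel κ] (Δ : ℝ)

lemma measurable_gamBars : Measurable (gamBars P κ Δ) :=
  (measurable_logSelfInfo Δ (gamGivenX P κ Δ) (measurable_gam P κ Δ)).prodMk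
    (measurable_logSelfInfo Δ (Kernel.const 𝒳 (gamLaw P κ Δ)) (measurable_gam P κ Δ))

lemma mul_cell_le {Δ : ℝ} (hΔ : 0 < Δ) (t : ℝ) : Δ * cell Δ t ≤ t := by
  have h := Int.floor_le (t / Δ)
  rw [le_div_iff₀ hΔ] at h
  rw [mul_comm]; exact h

lemma lt_mul_cell_add {Δ : ℝ} (hΔ : 0 < Δ) (t : ℝ) : t < Δ * cell Δ t + Δ := by
  have h := Int.lt_floor_add_one (t / Δ)
  rw [div_lt_iff₀ hΔ] at h
  have : (⌊t / Δ⌋ + 1 : ℝ) * Δ = Δ * cell Δ t + Δ := by rw [cell]; ring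
  linarith

/-- Almost sure properties of an input `x`: the conditional laws given `X = x` are those of
functions of `Y ∼ κ x`, and on a level set of `Γ` the measure `κ x` is dominated by a multiple of
the output law, or, in the singular case, of the joint law of the output and `Γ`. -/
structure GoodInput (x : 𝒳) : Prop where
  side_eq : sideGivenX P κ Δ x = (κ x).map fun y => side P κ Δ (x, y)
  gam_eq : gamGivenX P κ Δ x = (κ x).map fun y => gam P κ Δ (x, y)
  bars_eq : condDistrib (gamBars P κ Δ) Prod.fst (P ⊗ₘ κ) x =
    (κ x).map fun y => gamBars P κ Δ (x, y)
  gam_cond : ∀ b, κ x {y | gamBars P κ Δ (x, y) = b} ≠ 0 →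
    condDistrib (gam P κ Δ) (fun z => (z.1, gamBars P κ Δ z)) (P ⊗ₘ κ) (x, b) =
      (cond (κ x) {y | gamBars P κ Δ (x, y) = b}).map fun y => gam P κ Δ (x, y)
  snd_cond : ∀ g, κ x {y | gam P κ Δ (x, y) = g} ≠ 0 →
    condDistrib Prod.snd (fun z => (z.1, gam P κ Δ z)) (P ⊗ₘ κ) (x, g) =
      cond (κ x) {y | gam P κ Δ (x, y) = g}
  side_ac : ∀ t, sideLaw P κ Δ {t} = 0 → κ x {y | side P κ Δ (x, y) = t} = 0
  gam_ac : ∀ g, gamLaw P κ Δ {g} = 0 → κ x {y | gam P κ Δ (x, y) = g} = 0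
  level_le : ∀ (g : ℤ) (A : Set 𝒴), MeasurableSet A → κ x (A ∩ {y | gam P κ Δ (x, y) = g}) ≤
    ENNReal.ofReal (2 ^ (Δ * g + Δ)) * (κ ∘ₘ P) A
  level_le_of_isSingular : IsSingular P κ → ∀ (g : ℤ) (A : Set 𝒴), MeasurableSet A →
    κ x (A ∩ {y | gam P κ Δ (x, y) = g}) ≤
      ENNReal.ofReal (2 ^ (Δ * g + Δ)) * (P ⊗ₘ κ) {z | gam P κ Δ z = g ∧ z.2 ∈ A}

lemma measurable_density : Measurable (density P κ) := Kernel.measurable_rnDeriv _ _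

/-- On a level set of `Γ` the density is at most `2 ^ (γ + Δ)`. -/
lemma measure_level_le {Δ : ℝ} (hΔ : 0 < Δ) {x : 𝒳} (hx : κ x ≪ κ ∘ₘ P) (g : ℤ) {A : Set 𝒴}
    (hA : MeasurableSet A) :
    κ x (A ∩ {y | gam P κ Δ (x, y) = g}) ≤ ENNReal.ofReal (2 ^ (Δ * g + Δ)) * (κ ∘ₘ P) A := by
  have hgm : MeasurableSet {y | gam P κ Δ (x, y) = g} :=
    ((measurable_gam P κ Δ).comp measurable_prodMk_left) (measurableSet_singleton g)
  have hd : κ x = (κ ∘ₘ P).withDensity fun y => density P κ (x, y) := by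
    have h1 := Kernel.withDensity_rnDeriv_eq (κ := κ) (η := Kernel.const 𝒳 (κ ∘ₘ P)) (a := x)
      (by simpa using hx)
    rw [Kernel.withDensity_apply _ (Kernel.measurable_rnDeriv _ _), Kernel.const_apply] at h1
    exact h1.symm
  have htop : ∀ᵐ y ∂(κ ∘ₘ P), density P κ (x, y) < ⊤ := by
    have := Kernel.rnDeriv_lt_top κ (Kernel.const 𝒳 (κ ∘ₘ P)) (a := x)
    rw [Kernel.const_apply] at this
    exact this
  conv_lhs => rw [hd]
  rw [withDensity_apply _ (hA.inter hgm)]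
  calc ∫⁻ y in A ∩ {y | gam P κ Δ (x, y) = g}, density P κ (x, y) ∂(κ ∘ₘ P)
      ≤ ∫⁻ _ in A ∩ {y | gam P κ Δ (x, y) = g}, ENNReal.ofReal (2 ^ (Δ * g + Δ)) ∂(κ ∘ₘ P) := by
        refine lintegral_mono_ae ?_
        filter_upwards [ae_restrict_mem (hA.inter hgm), ae_restrict_of_ae htop] with y hy hyt
        have hyg : gam P κ Δ (x, y) = g := hy.2
        rw [← ENNReal.ofReal_toReal hyt.ne]
        refine ENNReal.ofReal_le_ofReal ?_
        rcases eq_or_lt_of_le (ENNReal.toReal_nonneg (a := density P κ (x, y))) with h0 | h0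
        · rw [← h0]; positivity
        · have h1 := lt_mul_cell_add hΔ (Real.logb 2 (density P κ (x, y)).toReal)
          rw [← hyg, ← Real.logb_le_iff_le_rpow (by norm_num) h0]
          exact h1.le
    _ ≤ ENNReal.ofReal (2 ^ (Δ * g + Δ)) * (κ ∘ₘ P) A := by
        rw [setLIntegral_const]
        gcongr
        exact Set.inter_subset_left

lemma ae_absolutelyContinuous (hac : P ⊗ₘ κ ≪ P.prod (κ ∘ₘ P)) : ∀ᵐ x ∂P, κ x ≪ κ ∘ₘ P := by
  rw [← Measure.compProd_const] at hac
  filter_upwards [hac.kernel_of_compProd] with x hx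
  simpa using hx

/-- Almost every input is good. In the singular case `Γ` is a function of the output, so that the
bound of `measure_level_le` can be applied to the part of `A` on which this function equals `g`. -/
lemma ae_goodInput {Δ : ℝ} (hΔ : 0 < Δ) (hac : P ⊗ₘ κ ≪ P.prod (κ ∘ₘ P)) :
    ∀ᵐ x ∂P, GoodInput P κ Δ x := by
  have hsing : ∀ᵐ x ∂P, IsSingular P κ → ∀ (g : ℤ) (A : Set 𝒴), MeasurableSet A →
      κ x (A ∩ {y | gam P κ Δ (x, y) = g}) ≤
        ENNReal.ofReal (2 ^ (Δ * g + Δ)) * (P ⊗ₘ κ) {z | gam P κ Δ z = g ∧ z.2 ∈ A} := by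
    by_cases hs : IsSingular P κ
    swap
    · exact Filter.Eventually.of_forall fun x h => absurd h hs
    obtain ⟨h, hh, heq⟩ := hs
    -- in the singular case `Γ` is almost surely the function `G` of the output
    let G : 𝒴 → ℤ := fun y => cell Δ (Real.logb 2 (h y).toReal)
    have hG : Measurable G := (measurable_cell Δ).comp
      ((Real.measurable_log.comp hh.ennreal_toReal).div_const _)
    have hgG : ∀ᵐ z ∂(P ⊗ₘ κ), gam P κ Δ z = G z.2 := by
      filter_upwards [heq] with z hz
      simp only [gam, G, hz]
    filter_upwards [Measure.ae_ae_of_ae_compProd hgG, ae_absolutelyContinuous P κ hac]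
      with x hx hxac _ g A hA
    have hAG : MeasurableSet (A ∩ {y | G y = g}) := hA.inter (hG (measurableSet_singleton g))
    have hmono : κ x (A ∩ {y | gam P κ Δ (x, y) = g}) ≤
        κ x ((A ∩ {y | G y = g}) ∩ {y | gam P κ Δ (x, y) = g}) := by
      refine measure_mono_ae ?_
      filter_upwards [hx] with y hy hyA
      exact ⟨⟨hyA.1, (hy.symm.trans hyA.2 : G y = g)⟩, hyA.2⟩
    refine hmono.trans ((measure_level_le P κ hΔ hxac g hAG).trans ?_)
    gcongr
    rw [← Measure.snd_compProd, Measure.snd_apply hAG]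
    refine measure_mono_ae ?_
    filter_upwards [hgG] with z hz hzA
    exact ⟨hz.trans hzA.2, hzA.1⟩
  filter_upwards [condDistrib_fst_ae P κ (measurable_side P κ Δ),
    condDistrib_fst_ae P κ (measurable_gam P κ Δ),
    condDistrib_fst_ae P κ (measurable_gamBars P κ Δ),
    condDistrib_pair_ae P κ (measurable_gamBars P κ Δ) (measurable_gam P κ Δ),
    condDistrib_pair_ae P κ (measurable_gam P κ Δ) measurable_snd,
    ae_measure_eq_zero_of_map (P := P) (κ := κ) (measurable_side P κ Δ),
    ae_measure_eq_zero_of_map (P := P) (κ := κ) (measurable_gam P κ Δ),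
    ae_absolutelyContinuous P κ hac, hsing] with x h1 h2 h3 h4 h5 h6 h7 h8 h9
  exact ⟨h1, h2, h3, h4, fun g hg => by rw [h5 g hg]; exact Measure.map_id, h6, h7,
    fun g A hA => measure_level_le P κ hΔ h8 g hA, h9⟩

end Scheme

/-! ### The ceilings dominate the likelihood ratios -/

section Scheme

set_option linter.unusedSectionVars false

variable {𝒳 𝒴 : Type*} [MeasurableSpace 𝒳] [StandardBorelSpace 𝒳]
  [MeasurableSpace 𝒴] [StandardBorelSpace 𝒴] [Nonempty 𝒴]
  {P : Measure 𝒳} [IsProbabilityMeasure P] {κ : Kernel 𝒳 𝒴} [IsMarkovKernel κ] {Δ : ℝ}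

lemma le_rpow_neg_cell (hΔ : 0 < Δ) {p : ℝ} (hp : 0 < p) {j : ℤ}
    (hj : cell Δ (Real.logb 2 (1 / p)) = j) : p ≤ 2 ^ (-(Δ * j)) := by
  have h := mul_cell_le hΔ (Real.logb 2 (1 / p))
  rw [hj, Real.le_logb_iff_rpow_le (by norm_num) (by positivity), le_div_iff₀ hp] at h
  rw [Real.rpow_neg (by norm_num), ← one_div, le_div_iff₀ (by positivity), mul_comm]
  exact h

lemma inv_le_rpow_cell (hΔ : 0 < Δ) {p : ℝ} (hp : 0 < p) {j : ℤ}
    (hj : cell Δ (Real.logb 2 (1 / p)) = j) : p⁻¹ ≤ 2 ^ (Δ * j + Δ) := by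
  have h := (lt_mul_cell_add hΔ (Real.logb 2 (1 / p))).le
  rw [hj, Real.logb_le_iff_le_rpow (by norm_num) (by positivity), one_div] at h
  exact h

lemma measurable_gam_section (x : 𝒳) : Measurable fun y => gam P κ Δ (x, y) :=
  (measurable_gam P κ Δ).comp measurable_prodMk_left

lemma measurable_gamBars_section (x : 𝒳) : Measurable fun y => gamBars P κ Δ (x, y) :=
  (measurable_gamBars P κ Δ).comp measurable_prodMk_left

lemma measurable_side_section (x : 𝒳) : Measurable fun y => side P κ Δ (x, y) :=
  (measurable_side P κ Δ).comp measurable_prodMk_left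

/-- Since `Γ̄̄` is a function of `x`, `Γ̄₁` and `Γ̄₂`, the event that the triple takes a given
possible value is determined by its first two components. -/
lemma setOf_gamBars_eq {x : 𝒳} {t : ℤ × ℤ × ℤ} {y : 𝒴} (hy : side P κ Δ (x, y) = t) :
    {y | gamBars P κ Δ (x, y) = (t.1, t.2.1)} = {y | side P κ Δ (x, y) = t} := by
  ext y'
  simp only [Set.mem_ofPred_eq]
  constructor
  · intro h
    have h1 : gamBars P κ Δ (x, y') = gamBars P κ Δ (x, y) := by
      rw [h, ← hy]; rfl
    rw [← hy]
    simp only [side]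
    have h2 : gamBarBar P κ Δ (x, y') = gamBarBar P κ Δ (x, y) := by
      simp only [gamBarBar, h1]
    rw [h2]
    simp only [gamBars, Prod.mk.injEq] at h1
    rw [h1.1, h1.2]
  · intro h
    rw [← h]; rfl

namespace GoodInput

variable {x : 𝒳}

/-- The target of the first stage is the law of `Γ` under `κ x` conditioned on the triple. -/
lemma target_aux_eq (hx : GoodInput P κ Δ x) {t : ℤ × ℤ × ℤ}
    (ht : κ x {y | side P κ Δ (x, y) = t} ≠ 0) :
    condDistrib (gam P κ Δ) (fun z => (z.1, gamBars P κ Δ z)) (P ⊗ₘ κ) (x, t.1, t.2.1) =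
      (cond (κ x) {y | side P κ Δ (x, y) = t}).map fun y => gam P κ Δ (x, y) := by
  obtain ⟨y, hy⟩ := nonempty_of_measure_ne_zero ht
  have h := setOf_gamBars_eq (P := P) (κ := κ) (Δ := Δ) (x := x) hy
  rw [hx.gam_cond _ (by rw [h]; exact ht), h]

/-- The conditional probability of `Γ` in terms of `Γ̄₁`. -/
lemma real_gam_facts (hx : GoodInput P κ Δ x) {y : 𝒴} {t : ℤ × ℤ × ℤ} {g : ℤ}
    (hy : side P κ Δ (x, y) = t) (hg : gam P κ Δ (x, y) = g) :
    cell Δ (Real.logb 2 (1 / (κ x).real {y | gam P κ Δ (x, y) = g})) = t.1 := by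
  have h : gamBar₁ P κ Δ (x, y) = t.1 := by rw [← hy]; rfl
  rw [gamBar₁, hx.gam_eq, map_measureReal_apply (measurable_gam_section x)
    (measurableSet_singleton _), hg] at h
  exact h

/-- The probability of `Γ` in terms of `Γ̄₂`. -/
lemma real_gamLaw_facts {y : 𝒴} {t : ℤ × ℤ × ℤ} {g : ℤ}
    (hy : side P κ Δ (x, y) = t) (hg : gam P κ Δ (x, y) = g) :
    cell Δ (Real.logb 2 (1 / (gamLaw P κ Δ).real {g})) = t.2.1 := by
  have h : gamBar₂ P κ Δ (x, y) = t.2.1 := by rw [← hy]; rfl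
  rw [gamBar₂, hg] at h
  exact h

/-- The conditional probability of the triple in terms of `Γ̄̄`. -/
lemma real_side_facts (hx : GoodInput P κ Δ x) {y : 𝒴} {t : ℤ × ℤ × ℤ}
    (hy : side P κ Δ (x, y) = t) :
    cell Δ (Real.logb 2 (1 / (κ x).real {y | side P κ Δ (x, y) = t})) = t.2.2 := by
  have h : gamBarBar P κ Δ (x, y) = t.2.2 := by rw [← hy]; rfl
  have hb : gamBars P κ Δ (x, y) = (t.1, t.2.1) := by rw [← hy]; rfl
  rw [gamBarBar, hx.bars_eq, map_measureReal_apply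
    (measurable_gamBars_section x) (measurableSet_singleton _), hb] at h
  rw [← setOf_gamBars_eq hy]
  exact h

/-- The ceiling `τ_aux` dominates the likelihood ratio of the first stage. The target gives `γ` a
probability of at most `p_{Γ|X}(γ|x) / p(γ̄₁, γ̄₂|x)`, where the probabilities involved
satisfy `p_{Γ|X}(γ|x) ≤ 2 ^ (-γ̄₁)`, `1 / p_Γ(γ) ≤ 2 ^ (γ̄₂ + Δ)` and
`1 / p(γ̄₁, γ̄₂|x) ≤ 2 ^ (γ̄̄ + Δ)`. -/
theorem target_aux_le (hx : GoodInput P κ Δ x) (hΔ : 0 < Δ) {t : ℤ × ℤ × ℤ}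
    (ht : κ x {y | side P κ Δ (x, y) = t} ≠ 0) :
    condDistrib (gam P κ Δ) (fun z => (z.1, gamBars P κ Δ z)) (P ⊗ₘ κ) (x, t.1, t.2.1) ≤
      ENNReal.ofReal (tauAux Δ t) • gamLaw P κ Δ := by
  rw [hx.target_aux_eq ht]
  refine measure_le_of_singleton_le fun g => ?_
  have hS : MeasurableSet {y | side P κ Δ (x, y) = t} :=
    measurable_side_section x (measurableSet_singleton t)
  rw [Measure.map_apply (measurable_gam_section x) (measurableSet_singleton g), cond_apply hS,
    Measure.smul_apply, smul_eq_mul]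
  by_cases h0 : κ x ({y | side P κ Δ (x, y) = t} ∩ (fun y => gam P κ Δ (x, y)) ⁻¹' {g}) = 0
  · rw [h0, mul_zero]; exact zero_le
  obtain ⟨y, hy, hyg⟩ := nonempty_of_measure_ne_zero h0
  have hyg' : gam P κ Δ (x, y) = g := hyg
  have hg0 : κ x {y | gam P κ Δ (x, y) = g} ≠ 0 :=
    fun h => h0 (measure_mono_null Set.inter_subset_right h)
  have hL0 : gamLaw P κ Δ {g} ≠ 0 := fun h => hg0 (hx.gam_ac g h)
  set a := (κ x).real {y | gam P κ Δ (x, y) = g} with ha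
  set b := (gamLaw P κ Δ).real {g} with hb
  set s := (κ x).real {y | side P κ Δ (x, y) = t} with hs
  have ha0 : 0 < a := ENNReal.toReal_pos hg0 (measure_ne_top _ _)
  have hb0 : 0 < b := ENNReal.toReal_pos hL0 (measure_ne_top _ _)
  have hs0 : 0 < s := ENNReal.toReal_pos ht (measure_ne_top _ _)
  have ha1 := le_rpow_neg_cell hΔ ha0 (hx.real_gam_facts hy hyg')
  have hb1 := inv_le_rpow_cell hΔ hb0 (real_gamLaw_facts hy hyg')
  have hs1 := inv_le_rpow_cell hΔ hs0 (hx.real_side_facts hy)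
  have hmain : s⁻¹ * a ≤ tauAux Δ t * b := by
    have h1 : 1 ≤ 2 ^ (Δ * t.2.1 + Δ) * b := by
      have := mul_le_mul_of_nonneg_right hb1 hb0.le
      rwa [inv_mul_cancel₀ hb0.ne'] at this
    calc s⁻¹ * a ≤ 2 ^ (Δ * t.2.2 + Δ) * 2 ^ (-(Δ * t.1)) * 1 := by
          rw [mul_one]; exact mul_le_mul hs1 ha1 ha0.le (by positivity)
      _ ≤ 2 ^ (Δ * t.2.2 + Δ) * 2 ^ (-(Δ * t.1)) * (2 ^ (Δ * t.2.1 + Δ) * b) :=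
          mul_le_mul_of_nonneg_left h1 (by positivity)
      _ = 2 ^ ((Δ * t.2.2 + Δ) + (-(Δ * t.1)) + (Δ * t.2.1 + Δ)) * b := by
          rw [Real.rpow_add (by norm_num) (Δ * t.2.2 + Δ + -(Δ * t.1)),
            Real.rpow_add (by norm_num) (Δ * t.2.2 + Δ)]
          ring
      _ ≤ tauAux Δ t * b := by
          refine mul_le_mul_of_nonneg_right ?_ hb0.le
          refine Real.rpow_le_rpow_of_exponent_le (by norm_num) ?_
          linarith
  calc (κ x {y | side P κ Δ (x, y) = t})⁻¹ *
        κ x ({y | side P κ Δ (x, y) = t} ∩ (fun y => gam P κ Δ (x, y)) ⁻¹' {g})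
      ≤ (κ x {y | side P κ Δ (x, y) = t})⁻¹ * κ x {y | gam P κ Δ (x, y) = g} := by
        gcongr
        exact Set.inter_subset_right
    _ = ENNReal.ofReal (s⁻¹ * a) := by
        rw [ENNReal.ofReal_mul (by positivity), ENNReal.ofReal_inv_of_pos hs0, hs, ha,
          ofReal_measureReal, ofReal_measureReal]
    _ ≤ ENNReal.ofReal (tauAux Δ t * b) := ENNReal.ofReal_le_ofReal hmain
    _ = ENNReal.ofReal (tauAux Δ t) * gamLaw P κ Δ {g} := by
        rw [ENNReal.ofReal_mul (by unfold tauAux; positivity), hb, ofReal_measureReal]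

/-- The ceiling `τ` dominates the likelihood ratio of the second stage. The target is `κ x`
conditioned on a level set of `Γ`, where the density is at most `2 ^ (γ + Δ)`; the conditioning
costs a factor `1 / p_{Γ|X}(γ|x) ≤ 2 ^ (γ̄₁ + Δ)`. In the singular case the level set has output
probability `p_Γ(γ) ≤ 2 ^ (-γ̄₂)`, which is gained by conditioning the proposal on `Γ` as well. -/
theorem target_primary_le (hx : GoodInput P κ Δ x) (hΔ : 0 < Δ) {t : ℤ × ℤ × ℤ} {g : ℤ}
    (htg : κ x ({y | side P κ Δ (x, y) = t} ∩ {y | gam P κ Δ (x, y) = g}) ≠ 0) :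
    condDistrib Prod.snd (fun z => (z.1, gam P κ Δ z)) (P ⊗ₘ κ) (x, g) ≤
      ENNReal.ofReal (tauPrimary P κ Δ t g) • proposal P κ Δ g := by
  obtain ⟨y, hy, hyg⟩ := nonempty_of_measure_ne_zero htg
  have hyg' : gam P κ Δ (x, y) = g := hyg
  have hg0 : κ x {y | gam P κ Δ (x, y) = g} ≠ 0 :=
    fun h => htg (measure_mono_null Set.inter_subset_right h)
  have hL0 : gamLaw P κ Δ {g} ≠ 0 := fun h => hg0 (hx.gam_ac g h)
  set a := (κ x).real {y | gam P κ Δ (x, y) = g} with ha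
  set b := (gamLaw P κ Δ).real {g} with hb
  have ha0 : 0 < a := ENNReal.toReal_pos hg0 (measure_ne_top _ _)
  have hb0 : 0 < b := ENNReal.toReal_pos hL0 (measure_ne_top _ _)
  have ha1 := inv_le_rpow_cell hΔ ha0 (hx.real_gam_facts hy hyg')
  have hb1 := le_rpow_neg_cell hΔ hb0 (real_gamLaw_facts hy hyg')
  have hainv : (κ x {y | gam P κ Δ (x, y) = g})⁻¹ ≤ ENNReal.ofReal (2 ^ (Δ * t.1 + Δ)) := by
    rw [← ofReal_measureReal (μ := κ x), ← ENNReal.ofReal_inv_of_pos ha0]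
    exact ENNReal.ofReal_le_ofReal ha1
  have hgm : MeasurableSet {y | gam P κ Δ (x, y) = g} :=
    measurable_gam_section x (measurableSet_singleton g)
  rw [hx.snd_cond g hg0, Measure.le_iff]
  intro A hA
  rw [cond_apply hgm, Measure.smul_apply, smul_eq_mul, Set.inter_comm]
  by_cases hsing : IsSingular P κ
  · have hW : (P ⊗ₘ κ) {z | gam P κ Δ z = g ∧ z.2 ∈ A} =
        gamLaw P κ Δ {g} * proposal P κ Δ g A := by
      rw [proposal, if_pos hsing, condDistrib_apply_of_ne_zero measurable_snd g hL0,
        ← mul_assoc, ← gamLaw, ENNReal.mul_inv_cancel hL0 (measure_ne_top _ _), one_mul,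
        Measure.map_apply ((measurable_gam P κ Δ).prodMk measurable_snd)
          ((measurableSet_singleton g).prod hA)]
      rfl
    have hb2 : gamLaw P κ Δ {g} ≤ ENNReal.ofReal (2 ^ (-(Δ * t.2.1))) := by
      rw [← ofReal_measureReal (μ := gamLaw P κ Δ)]
      exact ENNReal.ofReal_le_ofReal hb1
    calc (κ x {y | gam P κ Δ (x, y) = g})⁻¹ * κ x (A ∩ {y | gam P κ Δ (x, y) = g})
        ≤ ENNReal.ofReal (2 ^ (Δ * t.1 + Δ)) * (ENNReal.ofReal (2 ^ (Δ * g + Δ)) *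
            (ENNReal.ofReal (2 ^ (-(Δ * t.2.1))) * proposal P κ Δ g A)) := by
          refine mul_le_mul' hainv ((hx.level_le_of_isSingular hsing g A hA).trans ?_)
          rw [hW]
          gcongr
      _ = ENNReal.ofReal (tauPrimary P κ Δ t g) * proposal P κ Δ g A := by
          rw [← mul_assoc, ← mul_assoc, ← ENNReal.ofReal_mul (by positivity),
            ← ENNReal.ofReal_mul (by positivity), tauPrimary, if_pos hsing,
            ← Real.rpow_add (by norm_num), ← Real.rpow_add (by norm_num)]
          congr 3
          ring
  · calc (κ x {y | gam P κ Δ (x, y) = g})⁻¹ * κ x (A ∩ {y | gam P κ Δ (x, y) = g})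
        ≤ ENNReal.ofReal (2 ^ (Δ * t.1 + Δ)) * (ENNReal.ofReal (2 ^ (Δ * g + Δ)) *
            (κ ∘ₘ P) A) := mul_le_mul' hainv (hx.level_le g A hA)
      _ = ENNReal.ofReal (tauPrimary P κ Δ t g) * proposal P κ Δ g A := by
          rw [← mul_assoc, ← ENNReal.ofReal_mul (by positivity), tauPrimary, if_neg hsing,
            ← Real.rpow_add (by norm_num), proposal, if_neg hsing, Kernel.const_apply]
          congr 3
          ring

end GoodInput

end Scheme

/-! ### The joint law of the messages and of the output -/

section Scheme

set_option linter.unusedSectionVars false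

variable {𝒳 𝒴 : Type*} [MeasurableSpace 𝒳] [StandardBorelSpace 𝒳]
  [MeasurableSpace 𝒴] [StandardBorelSpace 𝒴] [Nonempty 𝒴]
  {P : Measure 𝒳} [IsProbabilityMeasure P] {κ : Kernel 𝒳 𝒴} [IsMarkovKernel κ] {Δ : ℝ}

/-- The output of the scheme: the entry selected in the second stage. -/
def output (P : Measure 𝒳) [IsProbabilityMeasure P] (κ : Kernel 𝒳 𝒴) [IsMarkovKernel κ] (Δ : ℝ)
    (x : 𝒳) (u : Seeds 𝒴) : 𝒴 :=
  u.2.2.2.1 (selectedGam P κ Δ x u) (sentJ P κ Δ x u)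

/-- The decoder recovers the entry selected by the encoder, since the concatenation of the three
codewords can be parsed in only one way. -/
lemma dec_enc (C : EntropyCodes P κ Δ) (x : 𝒳) (u : Seeds 𝒴) :
    (scheme P κ Δ C).dec ((scheme P κ Δ C).enc x u) u = output P κ Δ x u := by
  have hk : sentK P κ Δ x u ∈ atoms (indexLaw (tauAux Δ (sentSide P κ Δ x u))) := toAtom_mem _ _
  have hj : sentJ P κ Δ x u ∈ atoms (indexLaw
      (tauPrimary P κ Δ (sentSide P κ Δ x u) (u.2.1 (sentK P κ Δ x u)))) := toAtom_mem _ _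
  change decode P κ Δ C
    (codeword P κ Δ C u (sentSide P κ Δ x u) (sentK P κ Δ x u) (sentJ P κ Δ x u)) u = _
  set w := codeword P κ Δ C u (sentSide P κ Δ x u) (sentK P κ Δ x u) (sentJ P κ Δ x u) with hw
  have hspec := Classical.epsilon_spec (p := fun s : (ℤ × ℤ × ℤ) × ℕ × ℕ =>
    s.1 ∈ atoms (sideLaw P κ Δ) ∧ s.2.1 ∈ atoms (indexLaw (tauAux Δ s.1)) ∧
      s.2.2 ∈ atoms (indexLaw (tauPrimary P κ Δ s.1 (u.2.1 s.2.1))) ∧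
      codeword P κ Δ C u s.1 s.2.1 s.2.2 = w)
    ⟨(sentSide P κ Δ x u, sentK P κ Δ x u, sentJ P κ Δ x u), toAtom_mem _ _, hk, hj, rfl⟩
  rw [decode]
  generalize (Classical.epsilon fun s : (ℤ × ℤ × ℤ) × ℕ × ℕ =>
    s.1 ∈ atoms (sideLaw P κ Δ) ∧ s.2.1 ∈ atoms (indexLaw (tauAux Δ s.1)) ∧
      s.2.2 ∈ atoms (indexLaw (tauPrimary P κ Δ s.1 (u.2.1 s.2.1))) ∧
      codeword P κ Δ C u s.1 s.2.1 s.2.2 = w) = s at hspec ⊢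
  obtain ⟨t, k, j⟩ := s
  obtain ⟨h1, h2, h3, h4⟩ := hspec
  have h5 : codeword P κ Δ C u t k j <+: w := by rw [h4]
  rw [hw] at h5
  simp only [codeword] at h5 h1 h2 h3
  obtain ⟨e1, h5⟩ := C.side_optimal.1.append h1 (toAtom_mem _ _) h5
  change t = sentSide P κ Δ x u at e1
  subst e1
  obtain ⟨e2, h5⟩ := (C.index_optimal _).1.append h2 hk h5
  subst e2
  have e3 := (C.index_optimal _).1 _ h3 _ hj h5
  subst e3
  rfl

lemma measurable_sentSide :
    Measurable fun z : 𝒳 × Seeds 𝒴 => sentSide P κ Δ z.1 z.2 := by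
  have h1 : Measurable fun z : 𝒳 × Seeds 𝒴 => (z.1, z.2.1) := by fun_prop
  have h2 := (measurable_sample_kernel (sideGivenX P κ Δ)).comp h1
  have h3 := (measurable_of_countable (toAtom (sideLaw P κ Δ))).comp h2
  exact h3

lemma measurable_ratioAux :
    Measurable fun p : (𝒳 × ℤ × ℤ) × ℤ => ratioAux P κ Δ p.1 p.2 :=
  Kernel.measurable_rnDeriv _ _

lemma measurable_ratioPrimary :
    Measurable fun p : (𝒳 × ℤ) × 𝒴 => ratioPrimary P κ Δ p.1 p.2 :=
  Kernel.measurable_rnDeriv _ _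

lemma measurable_sentK : Measurable fun z : 𝒳 × Seeds 𝒴 => sentK P κ Δ z.1 z.2 := by
  have ht := measurable_sentSide (P := P) (κ := κ) (Δ := Δ)
  have hM := (measurable_of_countable (tauAux Δ)).comp ht
  have hr : Measurable fun p : (𝒳 × Seeds 𝒴) × ℤ => ratioAux P κ Δ
      (p.1.1, (sentSide P κ Δ p.1.1 p.1.2).1, (sentSide P κ Δ p.1.1 p.1.2).2.1) p.2 := by
    refine measurable_ratioAux.comp (Measurable.prodMk ?_ measurable_snd)
    have ht' : Measurable fun p : (𝒳 × Seeds 𝒴) × ℤ => sentSide P κ Δ p.1.1 p.1.2 :=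
      ht.comp measurable_fst
    exact (measurable_fst.comp measurable_fst).prodMk
      ((measurable_fst.comp ht').prodMk ((measurable_fst.comp measurable_snd).comp ht'))
  have hR := measurable_rejectionIndex (r := fun z : 𝒳 × Seeds 𝒴 => ratioAux P κ Δ
      (z.1, (sentSide P κ Δ z.1 z.2).1, (sentSide P κ Δ z.1 z.2).2.1)) hM hr
    (c := fun z : 𝒳 × Seeds 𝒴 => z.2.2.1) (v := fun z => z.2.2.2.1) (by fun_prop) (by fun_prop)
  have h := (measurable_of_countable fun p : (ℤ × ℤ × ℤ) × ℕ =>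
    toAtom (indexLaw (tauAux Δ p.1)) p.2).comp (ht.prodMk hR)
  exact h

lemma measurable_eval_of_countable {ι α : Type*} [Countable ι] [MeasurableSpace ι]
    [MeasurableSingletonClass ι] [MeasurableSpace α] :
    Measurable fun p : (ι → α) × ι => p.1 p.2 :=
  measurable_from_prod_countable_left fun k => measurable_pi_apply k

lemma measurable_selectedGam :
    Measurable fun z : 𝒳 × Seeds 𝒴 => selectedGam P κ Δ z.1 z.2 :=
  measurable_eval_of_countable.comp (f := fun z : 𝒳 × Seeds 𝒴 => (z.2.2.1, sentK P κ Δ z.1 z.2))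
    (Measurable.prodMk (by fun_prop) (measurable_sentK (P := P) (κ := κ) (Δ := Δ)))

lemma measurable_sentJ : Measurable fun z : 𝒳 × Seeds 𝒴 => sentJ P κ Δ z.1 z.2 := by
  have ht := measurable_sentSide (P := P) (κ := κ) (Δ := Δ)
  have hg := measurable_selectedGam (P := P) (κ := κ) (Δ := Δ)
  have htg := ht.prodMk hg
  have hM := (measurable_of_countable fun p : (ℤ × ℤ × ℤ) × ℤ => tauPrimary P κ Δ p.1 p.2).comp htg
  have hr : Measurable fun p : (𝒳 × Seeds 𝒴) × 𝒴 =>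
      ratioPrimary P κ Δ (p.1.1, selectedGam P κ Δ p.1.1 p.1.2) p.2 := by
    refine measurable_ratioPrimary.comp (Measurable.prodMk ?_ measurable_snd)
    have hg' : Measurable fun p : (𝒳 × Seeds 𝒴) × 𝒴 => selectedGam P κ Δ p.1.1 p.1.2 :=
      hg.comp measurable_fst
    exact (measurable_fst.comp measurable_fst).prodMk hg'
  have hc : Measurable fun z : 𝒳 × Seeds 𝒴 => z.2.2.2.2.1 (selectedGam P κ Δ z.1 z.2) :=
    measurable_eval_of_countable.comp
      (f := fun z : 𝒳 × Seeds 𝒴 => (z.2.2.2.2.1, selectedGam P κ Δ z.1 z.2))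
      (Measurable.prodMk (by fun_prop) hg)
  have hR := measurable_rejectionIndex
    (r := fun z : 𝒳 × Seeds 𝒴 => ratioPrimary P κ Δ (z.1, selectedGam P κ Δ z.1 z.2)) hM hr hc
    (v := fun z => z.2.2.2.2.2) (by fun_prop)
  have h := (measurable_of_countable fun p : ((ℤ × ℤ × ℤ) × ℤ) × ℕ =>
    toAtom (indexLaw (tauPrimary P κ Δ p.1.1 p.1.2)) p.2).comp (htg.prodMk hR)
  exact h

lemma measurable_output : Measurable fun z : 𝒳 × Seeds 𝒴 => output P κ Δ z.1 z.2 := by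
  have hc : Measurable fun z : 𝒳 × Seeds 𝒴 => z.2.2.2.2.1 (selectedGam P κ Δ z.1 z.2) :=
    measurable_eval_of_countable.comp
      (f := fun z : 𝒳 × Seeds 𝒴 => (z.2.2.2.2.1, selectedGam P κ Δ z.1 z.2))
      (Measurable.prodMk (by fun_prop) (measurable_selectedGam (P := P) (κ := κ) (Δ := Δ)))
  exact measurable_eval_of_countable.comp (hc.prodMk (measurable_sentJ (P := P) (κ := κ) (Δ := Δ)))

/-- Integration over the fibres of a discrete variable. -/
lemma lintegral_cond_fiber {α B : Type*} [MeasurableSpace α] [MeasurableSpace B] [Countable B]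
    [MeasurableSingletonClass B] {μ : Measure α} [IsProbabilityMeasure μ] {S : α → B}
    (hS : Measurable S) (f : α → ℝ≥0∞) :
    ∫⁻ b, ∫⁻ a, f a ∂(cond μ {a | S a = b}) ∂(μ.map S) = ∫⁻ a, f a ∂μ := by
  have hm : ∀ b, MeasurableSet {a | S a = b} := fun b => hS (measurableSet_singleton b)
  have hU : (⋃ b, {a | S a = b}) = Set.univ := by ext a; simp
  rw [lintegral_countable']
  conv_rhs => rw [← setLIntegral_univ, ← hU, lintegral_iUnion hm (fun b b' hbb' => by
    rw [Function.onFun, Set.disjoint_left]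
    intro a ha ha'
    exact hbb' (ha.symm.trans ha'))]
  refine tsum_congr fun b => ?_
  rw [Measure.map_apply hS (measurableSet_singleton b), ProbabilityTheory.cond,
    lintegral_smul_measure, smul_eq_mul]
  change _ * μ {a | S a = b} = _
  by_cases h0 : μ {a | S a = b} = 0
  · rw [h0, mul_zero, setLIntegral_measure_zero _ _ h0]
  · rw [mul_comm, ← mul_assoc, ENNReal.mul_inv_cancel h0 (measure_ne_top _ _), one_mul]

lemma lintegral_seedLaw_eq {Ψ : Seeds 𝒴 → ℝ≥0∞} (h : Measurable Ψ) :
    ∫⁻ u, Ψ u ∂(seedLaw P κ Δ) =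
      ∫⁻ v, ∫⁻ c, ∫⁻ v', ∫⁻ c', ∫⁻ w, Ψ (v, c, v', c', w)
        ∂(Measure.infinitePi fun _ : ℕ => (volume : Measure unitInterval))
        ∂(Measure.infinitePi fun g : ℤ => Measure.infinitePi fun _ : ℕ => proposal P κ Δ g)
        ∂(Measure.infinitePi fun _ : ℕ => (volume : Measure unitInterval))
        ∂(Measure.infinitePi fun _ : ℕ => gamLaw P κ Δ) := by
  rw [seedLaw, lintegral_prod _ h.aemeasurable]
  refine lintegral_congr fun v => ?_
  have h1 : Measurable fun w => Ψ (v, w) := h.comp measurable_prodMk_left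
  rw [lintegral_prod _ h1.aemeasurable]
  refine lintegral_congr fun c => ?_
  have h2 : Measurable fun w => Ψ (v, c, w) := h1.comp measurable_prodMk_left
  rw [lintegral_prod _ h2.aemeasurable]
  refine lintegral_congr fun v' => ?_
  have h3 : Measurable fun w => Ψ (v, c, v', w) := h2.comp measurable_prodMk_left
  rw [lintegral_prod _ h3.aemeasurable]

namespace GoodInput

variable {x : 𝒳}

/-- The conditional law of `Γ` given `X = x`, `Γ̄₁` and `Γ̄₂`: the target of the first stage. -/
abbrev targetAux (P : Measure 𝒳) [IsProbabilityMeasure P] (κ : Kernel 𝒳 𝒴) [IsMarkovKernel κ]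
    (Δ : ℝ) (x : 𝒳) (t : ℤ × ℤ × ℤ) : Measure ℤ :=
  condDistrib (gam P κ Δ) (fun z => (z.1, gamBars P κ Δ z)) (P ⊗ₘ κ) (x, t.1, t.2.1)

/-- The conditional law of `Y` given `X = x` and `Γ`: the target of the second stage. -/
abbrev targetPrimary (P : Measure 𝒳) [IsProbabilityMeasure P] (κ : Kernel 𝒳 𝒴) [IsMarkovKernel κ]
    (Δ : ℝ) (x : 𝒳) (g : ℤ) : Measure 𝒴 :=
  condDistrib Prod.snd (fun z => (z.1, gam P κ Δ z)) (P ⊗ₘ κ) (x, g)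

lemma ae_side_ne_zero (hx : GoodInput P κ Δ x) :
    ∀ᵐ t ∂(sideGivenX P κ Δ x), κ x {y | side P κ Δ (x, y) = t} ≠ 0 := by
  rw [ae_iff_of_countable]
  intro t ht
  rw [hx.side_eq, Measure.map_apply (measurable_side_section x) (measurableSet_singleton t)] at ht
  exact ht

lemma ae_inter_ne_zero (hx : GoodInput P κ Δ x) {t : ℤ × ℤ × ℤ}
    (ht : κ x {y | side P κ Δ (x, y) = t} ≠ 0) :
    ∀ᵐ g ∂(targetAux P κ Δ x t),
      κ x ({y | side P κ Δ (x, y) = t} ∩ {y | gam P κ Δ (x, y) = g}) ≠ 0 := by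
  rw [ae_iff_of_countable]
  intro g hg h0
  have hS : MeasurableSet {y | side P κ Δ (x, y) = t} :=
    measurable_side_section x (measurableSet_singleton t)
  apply hg
  rw [targetAux, hx.target_aux_eq ht, Measure.map_apply (measurable_gam_section x)
    (measurableSet_singleton g), cond_apply hS]
  exact mul_eq_zero_of_right _ h0

/-- The value `γ` selected by the first stage, together with the triple sent, has the conditional
law of `Γ` and of the triple given `X = x`. -/
lemma lintegral_side_targetAux (hx : GoodInput P κ Δ x) (ψ : ℤ × ℤ × ℤ → ℤ → ℝ≥0∞) :
    ∫⁻ t, ∫⁻ g, ψ t g ∂(targetAux P κ Δ x t) ∂(sideGivenX P κ Δ x) =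
      ∫⁻ y, ψ (side P κ Δ (x, y)) (gam P κ Δ (x, y)) ∂(κ x) := by
  rw [← lintegral_cond_fiber (measurable_side_section (P := P) (κ := κ) (Δ := Δ) x)
    (fun y => ψ (side P κ Δ (x, y)) (gam P κ Δ (x, y))), ← hx.side_eq]
  refine lintegral_congr_ae ?_
  filter_upwards [hx.ae_side_ne_zero] with t ht
  have hS : MeasurableSet {y | side P κ Δ (x, y) = t} :=
    measurable_side_section x (measurableSet_singleton t)
  rw [targetAux, hx.target_aux_eq ht, lintegral_map (measurable_of_countable _)
    (measurable_gam_section x)]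
  refine lintegral_congr_ae ?_
  filter_upwards [ae_cond_mem hS] with y hy
  rw [show side P κ Δ (x, y) = t from hy]

/-- If `γ` has the conditional law of `Γ` given `X = x`, sampling from the second target restores
the law `κ x` of the output. -/
lemma lintegral_gam_targetPrimary (hx : GoodInput P κ Δ x) (f : 𝒴 → ℝ≥0∞) :
    ∫⁻ y', ∫⁻ y, f y ∂(targetPrimary P κ Δ x (gam P κ Δ (x, y'))) ∂(κ x) = ∫⁻ y, f y ∂(κ x) := by
  rw [← lintegral_cond_fiber (measurable_gam_section (P := P) (κ := κ) (Δ := Δ) x) f,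
    ← lintegral_map (f := fun g => ∫⁻ y, f y ∂(targetPrimary P κ Δ x g))
      (measurable_of_countable _) (measurable_gam_section x)]
  refine lintegral_congr_ae ?_
  have h : ∀ᵐ g ∂((κ x).map fun y => gam P κ Δ (x, y)), κ x {y | gam P κ Δ (x, y) = g} ≠ 0 := by
    rw [ae_iff_of_countable]
    intro g hg
    rwa [Measure.map_apply (measurable_gam_section x) (measurableSet_singleton g)] at hg
  filter_upwards [h] with g hg
  rw [targetPrimary, hx.snd_cond g hg]

/-- The joint law, given `X = x`, of everything that the scheme transmits and of its output. In each
stage the selected index is independent of the selected entry. -/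
theorem lintegral_seedLaw (hx : GoodInput P κ Δ x) (hΔ : 0 < Δ)
    {Φ : ℤ × ℤ × ℤ → ℕ → ℤ → ℕ → 𝒴 → ℝ≥0∞} (hΦ : ∀ t k g j, Measurable (Φ t k g j)) :
    ∫⁻ u, Φ (sentSide P κ Δ x u) (sentK P κ Δ x u) (selectedGam P κ Δ x u) (sentJ P κ Δ x u)
        (output P κ Δ x u) ∂(seedLaw P κ Δ) =
      ∫⁻ t, ∫⁻ k, ∫⁻ g, ∫⁻ j, ∫⁻ y, Φ t k g j y ∂(targetPrimary P κ Δ x g)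
        ∂(indexLaw (tauPrimary P κ Δ t g)) ∂(targetAux P κ Δ x t) ∂(indexLaw (tauAux Δ t))
        ∂(sideGivenX P κ Δ x) := by
  have hΦm : Measurable fun p : ((ℤ × ℤ × ℤ) × ℕ × ℤ × ℕ) × 𝒴 =>
      Φ p.1.1 p.1.2.1 p.1.2.2.1 p.1.2.2.2 p.2 :=
    measurable_from_prod_countable_right fun d => hΦ d.1 d.2.1 d.2.2.1 d.2.2.2
  -- the integral over the seeds of the second stage, the first stage being given
  let H : ℤ × ℤ × ℤ → ℕ → ℤ → ℝ≥0∞ := fun t k g =>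
    ∫⁻ c : ℤ → ℕ → 𝒴, ∫⁻ v, Φ t k g (toAtom (indexLaw (tauPrimary P κ Δ t g))
        (rejectionIndex (tauPrimary P κ Δ t g) (ratioPrimary P κ Δ (x, g)) (c g) v))
      (c g (toAtom (indexLaw (tauPrimary P κ Δ t g))
        (rejectionIndex (tauPrimary P κ Δ t g) (ratioPrimary P κ Δ (x, g)) (c g) v)))
      ∂(Measure.infinitePi fun _ : ℕ => (volume : Measure unitInterval))
      ∂(Measure.infinitePi fun g : ℤ => Measure.infinitePi fun _ : ℕ => proposal P κ Δ g)
  have hH : ∀ t k g, κ x ({y | side P κ Δ (x, y) = t} ∩ {y | gam P κ Δ (x, y) = g}) ≠ 0 →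
      H t k g = ∫⁻ j, ∫⁻ y, Φ t k g j y ∂(targetPrimary P κ Δ x g)
        ∂(indexLaw (tauPrimary P κ Δ t g)) := by
    intro t k g htg
    have hr : Measurable (ratioPrimary P κ Δ (x, g)) :=
      measurable_ratioPrimary.comp measurable_prodMk_left
    have hrν : ratioPrimary P κ Δ (x, g) =ᵐ[proposal P κ Δ g]
        (targetPrimary P κ Δ x g).rnDeriv (proposal P κ Δ g) := by
      have := Kernel.rnDeriv_eq_rnDeriv_measure
        (κ := condDistrib Prod.snd (fun z => (z.1, gam P κ Δ z)) (P ⊗ₘ κ))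
        (η := (proposal P κ Δ).comap (Prod.snd : 𝒳 × ℤ → ℤ) measurable_snd) (a := (x, g))
      rwa [Kernel.comap_apply] at this
    rw [← lintegral_rejection hr hrν (hx.target_primary_le hΔ htg) (fun j => hΦ t k g j)]
    have hKm : Measurable fun p : (ℕ → 𝒴) × (ℕ → unitInterval) =>
        toAtom (indexLaw (tauPrimary P κ Δ t g))
          (rejectionIndex (tauPrimary P κ Δ t g) (ratioPrimary P κ Δ (x, g)) p.1 p.2) :=
      (measurable_of_countable (toAtom (indexLaw (tauPrimary P κ Δ t g)))).comp
        (measurable_rejectionIndex (M := fun _ => tauPrimary P κ Δ t g)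
          (r := fun _ => ratioPrimary P κ Δ (x, g))
          (c := fun p : (ℕ → 𝒴) × (ℕ → unitInterval) => p.1) (v := fun p => p.2) measurable_const
          (hr.comp measurable_snd) measurable_fst measurable_snd)
    have hF : Measurable fun p : ℕ × 𝒴 => Φ t k g p.1 p.2 :=
      measurable_from_prod_countable_right fun j => hΦ t k g j
    have hJm := hF.comp (hKm.prodMk (measurable_eval_of_countable.comp (measurable_fst.prodMk hKm)))
    exact (measurePreserving_eval_infinitePi
      (fun g : ℤ => Measure.infinitePi fun _ : ℕ => proposal P κ Δ g) g).lintegral_comp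
      (f := fun c => ∫⁻ v, Φ t k g (toAtom (indexLaw (tauPrimary P κ Δ t g))
        (rejectionIndex (tauPrimary P κ Δ t g) (ratioPrimary P κ Δ (x, g)) c v))
      (c (toAtom (indexLaw (tauPrimary P κ Δ t g))
        (rejectionIndex (tauPrimary P κ Δ t g) (ratioPrimary P κ Δ (x, g)) c v)))
      ∂(Measure.infinitePi fun _ : ℕ => (volume : Measure unitInterval)))
      hJm.lintegral_prod_right'
  -- the integral over all seeds but the first, the triple being given
  let L : ℤ × ℤ × ℤ → ℝ≥0∞ := fun t =>
    ∫⁻ c : ℕ → ℤ, ∫⁻ v, H t (toAtom (indexLaw (tauAux Δ t))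
        (rejectionIndex (tauAux Δ t) (ratioAux P κ Δ (x, t.1, t.2.1)) c v))
      (c (toAtom (indexLaw (tauAux Δ t))
        (rejectionIndex (tauAux Δ t) (ratioAux P κ Δ (x, t.1, t.2.1)) c v)))
      ∂(Measure.infinitePi fun _ : ℕ => (volume : Measure unitInterval))
      ∂(Measure.infinitePi fun _ : ℕ => gamLaw P κ Δ)
  have hL : ∀ t, κ x {y | side P κ Δ (x, y) = t} ≠ 0 →
      L t = ∫⁻ k, ∫⁻ g, ∫⁻ j, ∫⁻ y, Φ t k g j y ∂(targetPrimary P κ Δ x g)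
        ∂(indexLaw (tauPrimary P κ Δ t g)) ∂(targetAux P κ Δ x t) ∂(indexLaw (tauAux Δ t)) := by
    intro t ht
    have hr : Measurable (ratioAux P κ Δ (x, t.1, t.2.1)) := measurable_of_countable _
    have hrν : ratioAux P κ Δ (x, t.1, t.2.1) =ᵐ[gamLaw P κ Δ]
        (targetAux P κ Δ x t).rnDeriv (gamLaw P κ Δ) := by
      have := Kernel.rnDeriv_eq_rnDeriv_measure
        (κ := condDistrib (gam P κ Δ) (fun z => (z.1, gamBars P κ Δ z)) (P ⊗ₘ κ))
        (η := Kernel.const (𝒳 × ℤ × ℤ) (gamLaw P κ Δ)) (a := (x, t.1, t.2.1))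
      rwa [Kernel.const_apply] at this
    rw [show L t = _ from lintegral_rejection hr hrν (hx.target_aux_le hΔ ht)
      (F := H t) (fun k => measurable_of_countable _)]
    refine lintegral_congr fun k => lintegral_congr_ae ?_
    filter_upwards [hx.ae_inter_ne_zero ht] with g hg
    exact hH t k g hg
  have hsample : ∫⁻ v, L (toAtom (sideLaw P κ Δ) (sample (sideGivenX P κ Δ x) v)) =
      ∫⁻ t, L t ∂(sideGivenX P κ Δ x) := by
    have : IsProbabilityMeasure (sideGivenX P κ Δ x) := by
      unfold sideGivenX; infer_instance
    rw [← lintegral_map (f := fun t => L (toAtom (sideLaw P κ Δ) t)) (measurable_of_countable _)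
      (measurable_sample _), map_sample]
    refine lintegral_congr_ae ?_
    filter_upwards [hx.ae_side_ne_zero] with t ht
    have hta : t ∈ atoms (sideLaw P κ Δ) := fun h => ht (hx.side_ac t h)
    rw [toAtom, if_pos hta]
  have m1 := (measurable_sentSide (P := P) (κ := κ) (Δ := Δ)).comp (measurable_prodMk_left (x := x))
  have m2 := (measurable_sentK (P := P) (κ := κ) (Δ := Δ)).comp (measurable_prodMk_left (x := x))
  have m3 := (measurable_selectedGam (P := P) (κ := κ) (Δ := Δ)).comp
    (measurable_prodMk_left (x := x))
  have m4 := (measurable_sentJ (P := P) (κ := κ) (Δ := Δ)).comp (measurable_prodMk_left (x := x))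
  have m5 := (measurable_output (P := P) (κ := κ) (Δ := Δ)).comp (measurable_prodMk_left (x := x))
  have hfull' := hΦm.comp ((m1.prodMk (m2.prodMk (m3.prodMk m4))).prodMk m5)
  have hfull : Measurable fun u : Seeds 𝒴 => Φ (sentSide P κ Δ x u) (sentK P κ Δ x u)
      (selectedGam P κ Δ x u) (sentJ P κ Δ x u) (output P κ Δ x u) :=
    hfull'
  rw [lintegral_seedLaw_eq hfull]
  refine Eq.trans (lintegral_congr fun v => rfl : _ =
    ∫⁻ v, L (toAtom (sideLaw P κ Δ) (sample (sideGivenX P κ Δ x) v))) ?_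
  rw [hsample]
  refine lintegral_congr_ae ?_
  filter_upwards [hx.ae_side_ne_zero] with t ht
  exact hL t ht

end GoodInput

/-- The scheme simulates the channel: integrating out the indices and the triple from the joint law
of `GoodInput.lintegral_seedLaw` leaves `κ x`. -/
theorem scheme_simulates (hΔ : 0 < Δ) (hac : P ⊗ₘ κ ≪ P.prod (κ ∘ₘ P)) (C : EntropyCodes P κ Δ) :
    (scheme P κ Δ C).Simulates P κ := by
  have : IsProbabilityMeasure (seedLaw P κ Δ) := inferInstance
  have hm : Measurable fun z : 𝒳 × Seeds 𝒴 => (z.1, output P κ Δ z.1 z.2) :=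
    measurable_fst.prodMk measurable_output
  unfold Code.Simulates
  simp only [dec_enc]
  change AEMeasurable _ (P.prod (seedLaw P κ Δ)) ∧ Measure.map _ (P.prod (seedLaw P κ Δ)) = _
  refine ⟨hm.aemeasurable, ?_⟩
  ext S hS
  rw [Measure.map_apply hm hS, Measure.prod_apply (hm hS), Measure.compProd_apply hS]
  refine lintegral_congr_ae ?_
  filter_upwards [ae_goodInput P κ hΔ hac] with x hx
  have hSx : MeasurableSet (Prod.mk x ⁻¹' S) := measurable_prodMk_left hS
  have h1 := hx.lintegral_seedLaw hΔ
    (Φ := fun _ _ _ _ => (Prod.mk x ⁻¹' S).indicator 1)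
    (fun _ _ _ _ => measurable_one.indicator hSx)
  have h2 : MeasurableSet (Prod.mk x ⁻¹'
      ((fun z : 𝒳 × Seeds 𝒴 => (z.1, output P κ Δ z.1 z.2)) ⁻¹' S)) :=
    measurable_prodMk_left (hm hS)
  simp only [lintegral_const, measure_univ, mul_one] at h1
  rw [hx.lintegral_side_targetAux, hx.lintegral_gam_targetPrimary,
    lintegral_indicator_one hSx] at h1
  rw [← h1, ← lintegral_indicator_one h2]
  rfl

end Scheme

/-! ### The rate of the scheme -/

section Scheme

set_option linter.unusedSectionVars false

variable {𝒳 𝒴 : Type*} [MeasurableSpace 𝒳] [StandardBorelSpace 𝒳]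
  [MeasurableSpace 𝒴] [StandardBorelSpace 𝒴] [Nonempty 𝒴]
  {P : Measure 𝒳} [IsProbabilityMeasure P] {κ : Kernel 𝒳 𝒴} [IsMarkovKernel κ] {Δ : ℝ}

lemma lintegral_length_eq_expectedLength {α : Type*} [Countable α] [MeasurableSpace α]
    [MeasurableSingletonClass α] (μ : Measure α) (c : α → List Bool) :
    ∫⁻ a, ((c a).length : ℝ≥0∞) ∂μ = expectedLength μ c := by
  rw [lintegral_countable', expectedLength]
  exact tsum_congr fun a => mul_comm _ _

/-- The values taken by the triple and by `Γ` almost surely have positive probability. -/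
lemma ae_inter_self_ne_zero (x : 𝒳) :
    ∀ᵐ y ∂(κ x), κ x ({y' | side P κ Δ (x, y') = side P κ Δ (x, y)} ∩
      {y' | gam P κ Δ (x, y') = gam P κ Δ (x, y)}) ≠ 0 := by
  have hm : Measurable fun y => (side P κ Δ (x, y), gam P κ Δ (x, y)) :=
    (measurable_side_section x).prodMk (measurable_gam_section x)
  have h : ∀ᵐ p ∂((κ x).map fun y => (side P κ Δ (x, y), gam P κ Δ (x, y))),
      κ x ({y' | side P κ Δ (x, y') = p.1} ∩ {y' | gam P κ Δ (x, y') = p.2}) ≠ 0 := by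
    rw [ae_iff_of_countable]
    intro p hp
    rw [Measure.map_apply hm (measurableSet_singleton p)] at hp
    refine fun h0 => hp (measure_mono_null (fun y hy => ?_) h0)
    have hy' : (side P κ Δ (x, y), gam P κ Δ (x, y)) = p := hy
    exact ⟨congrArg Prod.fst hy', congrArg Prod.snd hy'⟩
  exact ae_of_ae_map hm.aemeasurable h

lemma ae_compProd_of_ae_ae {p : 𝒳 × 𝒴 → Prop} (hp : MeasurableSet {z | p z})
    (h : ∀ᵐ x ∂P, ∀ᵐ y ∂(κ x), p (x, y)) : ∀ᵐ z ∂(P ⊗ₘ κ), p z :=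
  Measure.ae_compProd_of_ae_ae hp h

lemma measurable_side_gam : Measurable fun z : 𝒳 × 𝒴 => (side P κ Δ z, gam P κ Δ z) :=
  (measurable_side P κ Δ).prodMk (measurable_gam P κ Δ)

/-- Both ceilings are almost surely at least one. -/
lemma ae_one_le_tau (hΔ : 0 < Δ) (hac : P ⊗ₘ κ ≪ P.prod (κ ∘ₘ P)) :
    ∀ᵐ z ∂(P ⊗ₘ κ), 1 ≤ tauAux Δ (side P κ Δ z) ∧
      1 ≤ tauPrimary P κ Δ (side P κ Δ z) (gam P κ Δ z) := by
  refine ae_compProd_of_ae_ae ?_ ?_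
  · exact measurable_side_gam (Set.to_countable
      {p : (ℤ × ℤ × ℤ) × ℤ | 1 ≤ tauAux Δ p.1 ∧ 1 ≤ tauPrimary P κ Δ p.1 p.2}).measurableSet
  · filter_upwards [ae_goodInput P κ hΔ hac] with x hx
    filter_upwards [ae_inter_self_ne_zero (P := P) (κ := κ) (Δ := Δ) x] with y hy
    exact ⟨one_le_of_le_smul (hx.target_aux_le hΔ
      fun h => hy (measure_mono_null Set.inter_subset_left h)),
      one_le_of_le_smul (hx.target_primary_le hΔ hy)⟩

/-- The expected length of the transmitted string, bounded in terms of the ceilings. -/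
lemma lintegral_length_le (hΔ : 0 < Δ) (hac : P ⊗ₘ κ ≪ P.prod (κ ∘ₘ P))
    (C : EntropyCodes P κ Δ) :
    ∫⁻ z, (((scheme P κ Δ C).enc z.1 z.2).length : ℝ≥0∞) ∂(P.prod (scheme P κ Δ C).law) ≤
      (entropy (sideLaw P κ Δ) + 1) + ∫⁻ z, ENNReal.ofReal (indexBound (tauAux Δ (side P κ Δ z)) +
        indexBound (tauPrimary P κ Δ (side P κ Δ z) (gam P κ Δ z))) ∂(P ⊗ₘ κ) := by
  let Φ : ℤ × ℤ × ℤ → ℕ → ℤ → ℕ → 𝒴 → ℝ≥0∞ := fun t k g j _ =>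
    ((C.sideWord t).length : ℝ≥0∞) + (((C.indexWord (tauAux Δ t) k).length : ℝ≥0∞) +
      ((C.indexWord (tauPrimary P κ Δ t g) j).length : ℝ≥0∞))
  let B : ℤ × ℤ × ℤ → ℤ → ℝ≥0∞ := fun t g => ((C.sideWord t).length : ℝ≥0∞) +
    (ENNReal.ofReal (indexBound (tauAux Δ t)) +
      ENNReal.ofReal (indexBound (tauPrimary P κ Δ t g)))
  have hBm := (measurable_of_countable fun p : (ℤ × ℤ × ℤ) × ℤ => B p.1 p.2).comp
    (measurable_side_gam (P := P) (κ := κ) (Δ := Δ))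
  have hlen : ∀ x u, (((scheme P κ Δ C).enc x u).length : ℝ≥0∞) =
      Φ (sentSide P κ Δ x u) (sentK P κ Δ x u) (selectedGam P κ Δ x u) (sentJ P κ Δ x u)
        (output P κ Δ x u) := by
    intro x u
    change ((codeword P κ Δ C u _ _ _).length : ℝ≥0∞) = _
    simp only [codeword, List.length_append, Nat.cast_add]
    rfl
  have hbound : ∀ M, 1 ≤ M → ∫⁻ k, ((C.indexWord M k).length : ℝ≥0∞) ∂(indexLaw M) ≤
      ENNReal.ofReal (indexBound M) := fun M hM => by
    rw [lintegral_length_eq_expectedLength]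
    exact expectedLength_indexLaw_le hM (C.index_optimal M)
  have hx : ∀ᵐ x ∂P, ∫⁻ u, (((scheme P κ Δ C).enc x u).length : ℝ≥0∞) ∂(seedLaw P κ Δ) ≤
      ∫⁻ y, B (side P κ Δ (x, y)) (gam P κ Δ (x, y)) ∂(κ x) := by
    filter_upwards [ae_goodInput P κ hΔ hac] with x hx
    simp only [hlen]
    rw [hx.lintegral_seedLaw hΔ (Φ := Φ) (fun t k g j => measurable_const),
      ← hx.lintegral_side_targetAux]
    refine lintegral_mono_ae ?_
    filter_upwards [hx.ae_side_ne_zero] with t ht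
    have hg : ∀ k, ∫⁻ g, ∫⁻ j, ∫⁻ y, Φ t k g j y ∂(GoodInput.targetPrimary P κ Δ x g)
        ∂(indexLaw (tauPrimary P κ Δ t g)) ∂(GoodInput.targetAux P κ Δ x t) ≤
        ∫⁻ g, (((C.indexWord (tauAux Δ t) k).length : ℝ≥0∞) +
          (((C.sideWord t).length : ℝ≥0∞) + ENNReal.ofReal (indexBound (tauPrimary P κ Δ t g))))
          ∂(GoodInput.targetAux P κ Δ x t) := by
      intro k
      refine lintegral_mono_ae ?_
      filter_upwards [hx.ae_inter_ne_zero ht] with g hg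
      simp only [Φ, lintegral_const, measure_univ, mul_one]
      rw [lintegral_add_left measurable_const, lintegral_add_left measurable_const,
        lintegral_const, measure_univ, mul_one, lintegral_const, measure_univ, mul_one,
        add_left_comm]
      gcongr
      exact hbound _ (one_le_of_le_smul (hx.target_primary_le hΔ hg))
    refine (lintegral_mono hg).trans ?_
    have h1 : ∀ k, ∫⁻ g, (((C.indexWord (tauAux Δ t) k).length : ℝ≥0∞) +
          (((C.sideWord t).length : ℝ≥0∞) + ENNReal.ofReal (indexBound (tauPrimary P κ Δ t g))))
          ∂(GoodInput.targetAux P κ Δ x t) = ((C.indexWord (tauAux Δ t) k).length : ℝ≥0∞) +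
        (((C.sideWord t).length : ℝ≥0∞) + ∫⁻ g, ENNReal.ofReal (indexBound (tauPrimary P κ Δ t g))
          ∂(GoodInput.targetAux P κ Δ x t)) := by
      intro k
      rw [lintegral_add_left measurable_const, lintegral_add_left measurable_const,
        lintegral_const, measure_univ, mul_one, lintegral_const, measure_univ, mul_one]
    rw [lintegral_congr h1, lintegral_add_right _ measurable_const, lintegral_const, measure_univ,
      mul_one]
    simp only [B]
    rw [lintegral_add_left measurable_const, lintegral_add_left measurable_const,
      lintegral_const, measure_univ, mul_one, lintegral_const, measure_univ, mul_one, add_left_comm]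
    gcongr
    exact hbound _ (one_le_of_le_smul (hx.target_aux_le hΔ ht))
  change ∫⁻ z, (((scheme P κ Δ C).enc z.1 z.2).length : ℝ≥0∞) ∂(P.prod (seedLaw P κ Δ)) ≤ _
  refine (lintegral_prod_le _).trans ((lintegral_mono_ae hx).trans ?_)
  have hsm : Measurable fun z : 𝒳 × 𝒴 => ((C.sideWord (side P κ Δ z)).length : ℝ≥0∞) := by
    have h := (measurable_of_countable
      (fun t => ((C.sideWord t).length : ℝ≥0∞))).comp (measurable_side P κ Δ)
    exact h
  rw [← Measure.lintegral_compProd (f := fun z => B (side P κ Δ z) (gam P κ Δ z)) hBm]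
  simp only [B]
  rw [lintegral_add_left hsm]
  refine add_le_add ?_ (le_of_eq ?_)
  · rw [← lintegral_map (f := fun t => ((C.sideWord t).length : ℝ≥0∞)) (measurable_of_countable _)
      (measurable_side P κ Δ), lintegral_length_eq_expectedLength]
    exact C.side_optimal.expectedLength_le_entropy_add_one
  · refine lintegral_congr_ae ?_
    filter_upwards [ae_one_le_tau hΔ hac] with z hz
    have hpos : ∀ M, 1 ≤ M → 0 ≤ indexBound M := by
      intro M hM
      have h1 : 0 ≤ Real.logb 2 M := Real.logb_nonneg (by norm_num) hM
      have h2 : 0 ≤ Real.logb 2 (Real.exp 1) :=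
        Real.logb_nonneg (by norm_num) (Real.one_le_exp zero_le_one)
      unfold indexBound
      linarith
    rw [ENNReal.ofReal_add (hpos _ hz.1) (hpos _ hz.2)]

/-- The density is a version of the Radon–Nikodym derivative of the joint law with respect to the
product of its marginals. -/
lemma density_ae_eq_rnDeriv (hac : P ⊗ₘ κ ≪ P.prod (κ ∘ₘ P)) :
    density P κ =ᵐ[P.prod (κ ∘ₘ P)] (P ⊗ₘ κ).rnDeriv (P.prod (κ ∘ₘ P)) := by
  have hd : Measurable (Function.uncurry (κ.rnDeriv (Kernel.const 𝒳 (κ ∘ₘ P)))) :=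
    Kernel.measurable_rnDeriv _ _
  have h : P ⊗ₘ κ = (P.prod (κ ∘ₘ P)).withDensity (density P κ) := by
    have h1 : (κ : 𝒳 → Measure 𝒴) =ᵐ[P] (Kernel.const 𝒳 (κ ∘ₘ P)).withDensity
        (κ.rnDeriv (Kernel.const 𝒳 (κ ∘ₘ P))) := by
      filter_upwards [ae_absolutelyContinuous P κ hac] with x hx
      exact (Kernel.withDensity_rnDeriv_eq (by simpa using hx)).symm
    rw [← Measure.compProd_const]
    conv_lhs => rw [Measure.compProd_congr h1, Measure.compProd_withDensity hd]
    rfl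
  conv_rhs => rw [h]
  exact (Measure.rnDeriv_withDensity _ (measurable_density P κ)).symm

/-- The mutual information is the expectation of the log-likelihood ratio. -/
lemma integral_logb_density (hI : mutualInfo P κ ≠ ⊤) :
    P ⊗ₘ κ ≪ P.prod (κ ∘ₘ P) ∧
      Integrable (fun z => Real.logb 2 (density P κ z).toReal) (P ⊗ₘ κ) ∧
      ENNReal.ofReal (∫ z, Real.logb 2 (density P κ z).toReal ∂(P ⊗ₘ κ)) = mutualInfo P κ := by
  have hlog2 : 0 < Real.log 2 := Real.log_pos (by norm_num)
  have hkl : InformationTheory.klDiv (P ⊗ₘ κ) (P.prod (κ ∘ₘ P)) ≠ ⊤ := by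
    intro h
    rw [mutualInfo, h, ENNReal.top_div_of_ne_top ENNReal.ofReal_ne_top] at hI
    exact hI rfl
  obtain ⟨hac, hint⟩ := InformationTheory.klDiv_ne_top_iff.1 hkl
  have hae : llr (P ⊗ₘ κ) (P.prod (κ ∘ₘ P)) =ᵐ[P ⊗ₘ κ]
      fun z => Real.log (density P κ z).toReal := by
    filter_upwards [hac.ae_le (density_ae_eq_rnDeriv hac)] with z hz
    rw [llr, hz]
  refine ⟨hac, (hint.congr hae).div_const _, ?_⟩
  simp only [Real.logb]
  rw [integral_div, ENNReal.ofReal_div_of_pos hlog2, mutualInfo,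
    InformationTheory.klDiv_of_ac_of_integrable hac hint, integral_congr_ae hae]
  simp

lemma measurable_conditional_selfInfo : Measurable fun p : 𝒳 × ℤ × ℤ × ℤ =>
    Real.logb 2 (1 / (sideGivenX P κ Δ p.1).real {p.2}) :=
  measurable_from_prod_countable_left fun t =>
    (Real.measurable_log.comp (measurable_const.div
      ((sideGivenX P κ Δ).measurable_coe
        (measurableSet_singleton t)).ennreal_toReal)).div_const _

/-- Conditioning on the input does not increase the entropy of the triple: Jensen's inequality for
`-t log t`, applied to the conditional probability of each value. -/
lemma lintegral_conditional_selfInfo_le :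
    ∫⁻ z, ENNReal.ofReal (Real.logb 2 (1 / (sideGivenX P κ Δ z.1).real {side P κ Δ z}))
      ∂(P ⊗ₘ κ) ≤ entropy (sideLaw P κ Δ) := by
  have hlog2 : 0 < Real.log 2 := Real.log_pos (by norm_num)
  have hMk : IsMarkovKernel (sideGivenX P κ Δ) := by unfold sideGivenX; infer_instance
  have hqm : ∀ t, Measurable fun x => (sideGivenX P κ Δ x).real {t} := fun t =>
    ((sideGivenX P κ Δ).measurable_coe (measurableSet_singleton t)).ennreal_toReal
  have hjm : Measurable fun p : 𝒳 × ℤ × ℤ × ℤ =>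
      ENNReal.ofReal (Real.logb 2 (1 / (sideGivenX P κ Δ p.1).real {p.2})) :=
    measurable_conditional_selfInfo.ennreal_ofReal
  have hgraph : Measurable fun z : 𝒳 × 𝒴 => (z.1, side P κ Δ z) :=
    measurable_fst.prodMk (measurable_side P κ Δ)
  rw [← lintegral_map (f := fun p : 𝒳 × ℤ × ℤ × ℤ =>
    ENNReal.ofReal (Real.logb 2 (1 / (sideGivenX P κ Δ p.1).real {p.2}))) hjm hgraph,
    ← compProd_map_condDistrib (measurable_side P κ Δ).aemeasurable, map_fst_compProd,
    ← sideGivenX, Measure.lintegral_compProd hjm]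
  have hpt : ∀ x, ∫⁻ t, ENNReal.ofReal (Real.logb 2 (1 / (sideGivenX P κ Δ x).real {t}))
      ∂(sideGivenX P κ Δ x) =
      ∑' t, ENNReal.ofReal (Real.negMulLog ((sideGivenX P κ Δ x).real {t}) / Real.log 2) := by
    intro x
    rw [← entropy, entropy_eq, lintegral_countable']
    exact tsum_congr fun t => mul_comm _ _
  have hφm : ∀ t, Measurable fun x => Real.negMulLog ((sideGivenX P κ Δ x).real {t}) := fun t =>
    Real.continuous_negMulLog.measurable.comp (hqm t)
  rw [lintegral_congr hpt, lintegral_tsum fun t =>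
    ((hφm t).div_const _).ennreal_ofReal.aemeasurable]
  refine ENNReal.tsum_le_tsum fun t => ?_
  set q : 𝒳 → ℝ := fun x => (sideGivenX P κ Δ x).real {t} with hq
  have hq0 : ∀ x, 0 ≤ q x := fun x => measureReal_nonneg
  have hq1 : ∀ x, q x ≤ 1 := fun x => measureReal_le_one
  have hqi : Integrable q P := Integrable.of_bound (hqm t).aestronglyMeasurable 1
    (Filter.Eventually.of_forall fun x => by rw [Real.norm_of_nonneg (hq0 x)]; exact hq1 x)
  have hφ0 : ∀ x, 0 ≤ Real.negMulLog (q x) := fun x => Real.negMulLog_nonneg (hq0 x) (hq1 x)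
  have hφ1 : ∀ x, Real.negMulLog (q x) ≤ 1 := by
    intro x
    have := Real.negMulLog_le_one_sub_self (hq0 x)
    linarith [hq0 x]
  have hφi : Integrable (fun x => Real.negMulLog (q x)) P := Integrable.of_bound
    (hφm t).aestronglyMeasurable 1
    (Filter.Eventually.of_forall fun x => by
      rw [Real.norm_of_nonneg (hφ0 x)]; exact hφ1 x)
  have hmean : ∫ x, q x ∂P = (sideLaw P κ Δ).real {t} := by
    have h1 : sideLaw P κ Δ = sideGivenX P κ Δ ∘ₘ P := by
      have := condDistrib_comp_map (μ := P ⊗ₘ κ) (X := Prod.fst) measurable_fst.aemeasurable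
        (measurable_side P κ Δ).aemeasurable
      rw [map_fst_compProd] at this
      exact this.symm
    rw [Measure.real, h1, Measure.bind_apply (measurableSet_singleton t)
      (Kernel.aemeasurable _), hq]
    simp only [Measure.real]
    exact integral_toReal ((sideGivenX P κ Δ).measurable_coe
      (measurableSet_singleton t)).aemeasurable (Filter.Eventually.of_forall fun x =>
        measure_lt_top _ _)
  have hjensen : ∫ x, Real.negMulLog (q x) ∂P ≤ Real.negMulLog (∫ x, q x ∂P) :=
    Real.concaveOn_negMulLog.le_map_integral Real.continuous_negMulLog.continuousOn isClosed_Ici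
      (Filter.Eventually.of_forall hq0) hqi hφi
  change ∫⁻ x, ENNReal.ofReal (Real.negMulLog (q x) / Real.log 2) ∂P ≤ _
  rw [← ofReal_integral_eq_lintegral_ofReal (hφi.div_const _)
    (Filter.Eventually.of_forall fun x => div_nonneg (hφ0 x) hlog2.le)]
  refine ENNReal.ofReal_le_ofReal ?_
  rw [integral_div, ← hmean]
  exact div_le_div_of_nonneg_right hjensen hlog2.le

lemma lintegral_selfInfo_gam :
    ∫⁻ z, ENNReal.ofReal (Real.logb 2 (1 / (gamLaw P κ Δ).real {gam P κ Δ z})) ∂(P ⊗ₘ κ) =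
      entropy (gamLaw P κ Δ) := by
  rw [← lintegral_map (f := fun g => ENNReal.ofReal (Real.logb 2 (1 / (gamLaw P κ Δ).real {g})))
    (measurable_of_countable _) (measurable_gam P κ Δ), ← gamLaw, lintegral_countable', entropy_eq]
  exact tsum_congr fun a => mul_comm _ _

/-- Subadditivity of the positive part of the expectation, for a sum whose first term need not be
nonnegative and whose second term need not be integrable. -/
lemma lintegral_ofReal_add_le {α : Type*} [MeasurableSpace α] {μ : Measure α} {f g : α → ℝ}
    (hf : Integrable f μ) (hg : Measurable g) (hg0 : ∀ a, 0 ≤ g a) (hfg : ∀ᵐ a ∂μ, 0 ≤ f a + g a) :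
    ∫⁻ a, ENNReal.ofReal (f a + g a) ∂μ ≤
      ENNReal.ofReal (∫ a, f a ∂μ) + ∫⁻ a, ENNReal.ofReal (g a) ∂μ := by
  by_cases htop : ∫⁻ a, ENNReal.ofReal (g a) ∂μ = ⊤
  · rw [htop, add_top]; exact le_top
  have hgi : Integrable g μ := by
    refine ⟨hg.aestronglyMeasurable, ?_⟩
    rw [hasFiniteIntegral_iff_ofReal (Filter.Eventually.of_forall hg0)]
    exact lt_top_iff_ne_top.2 htop
  have hsum := ofReal_integral_eq_lintegral_ofReal (hf.add hgi) hfg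
  simp only [Pi.add_apply] at hsum
  rw [← hsum, ← ofReal_integral_eq_lintegral_ofReal hgi (Filter.Eventually.of_forall hg0)]
  refine le_trans (le_of_eq ?_) ENNReal.ofReal_add_le
  rw [integral_add hf hgi]

/-- The conditional self-information of the triple dominates `Γ̄̄`, because `Γ̄̄` is a function of
the input, `Γ̄₁` and `Γ̄₂`. -/
lemma ae_mul_gamBarBar_le (hΔ : 0 < Δ) (hac : P ⊗ₘ κ ≪ P.prod (κ ∘ₘ P)) :
    ∀ᵐ z ∂(P ⊗ₘ κ), Δ * (side P κ Δ z).2.2 ≤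
      Real.logb 2 (1 / (sideGivenX P κ Δ z.1).real {side P κ Δ z}) := by
  have hqm : Measurable fun p : 𝒳 × ℤ × ℤ × ℤ =>
      Δ * (p.2.2.2 : ℝ) - Real.logb 2 (1 / (sideGivenX P κ Δ p.1).real {p.2}) := by
    have hs : Measurable fun p : 𝒳 × ℤ × ℤ × ℤ => p.2 := measurable_snd
    have h := (measurable_of_countable fun t : ℤ × ℤ × ℤ => Δ * (t.2.2 : ℝ)).comp hs
    exact h.sub measurable_conditional_selfInfo
  have hms : MeasurableSet {z : 𝒳 × 𝒴 | Δ * ((side P κ Δ z).2.2 : ℝ) ≤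
      Real.logb 2 (1 / (sideGivenX P κ Δ z.1).real {side P κ Δ z})} := by
    have h := measurableSet_le (hqm.comp (measurable_fst.prodMk (measurable_side P κ Δ)))
      (measurable_const (a := (0 : ℝ)))
    simpa only [Function.comp_def, sub_nonpos] using h
  refine ae_compProd_of_ae_ae hms ?_
  filter_upwards [ae_goodInput P κ hΔ hac] with x hx
  refine Filter.Eventually.of_forall fun y => ?_
  have h := mul_cell_le hΔ (Real.logb 2
    (1 / (κ x).real {y' | side P κ Δ (x, y') = side P κ Δ (x, y)}))
  rw [hx.real_side_facts (t := side P κ Δ (x, y)) rfl] at h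
  rw [hx.side_eq, map_measureReal_apply (measurable_side_section x) (measurableSet_singleton _)]
  exact h

/-- The bound on the length of the description of the two indices. The terms `γ̄₁` cancel in both
cases, and `γ̄₂` cancels in the singular case. -/
lemma indexBound_add_indexBound (t : ℤ × ℤ × ℤ) (g : ℤ) :
    indexBound (tauAux Δ t) + indexBound (tauPrimary P κ Δ t g) =
      (open Classical in if IsSingular P κ then 0 else Δ * t.2.1) + Δ * g + Δ * t.2.2 +
        (5 * Δ + 2 + 2 * Real.logb 2 (Real.exp 1)) := by
  unfold indexBound tauAux tauPrimary
  split_ifs <;> rw [Real.logb_rpow (by norm_num) (by norm_num),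
    Real.logb_rpow (by norm_num) (by norm_num)] <;> ring

/-- The bound on the expected length of the transmitted string. -/
theorem lintegral_length_le_mutualInfo (hΔ : 0 < Δ) (hI : mutualInfo P κ ≠ ⊤)
    (C : EntropyCodes P κ Δ) :
    ∫⁻ z, (((scheme P κ Δ C).enc z.1 z.2).length : ℝ≥0∞) ∂(P.prod (scheme P κ Δ C).law) ≤
      mutualInfo P κ + (open Classical in if IsSingular P κ then 0 else entropy (gamLaw P κ Δ)) +
        errorTerm P κ Δ := by
  classical
  obtain ⟨hac, hint, hmi⟩ := integral_logb_density hI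
  set c : ℝ := 5 * Δ + 2 + 2 * Real.logb 2 (Real.exp 1) with hc
  have hle : 0 ≤ Real.logb 2 (Real.exp 1) :=
    Real.logb_nonneg (by norm_num) (Real.one_le_exp zero_le_one)
  have hc0 : 0 ≤ c := by positivity
  let f : 𝒳 × 𝒴 → ℝ := fun z => Real.logb 2 (density P κ z).toReal + c
  let ι : 𝒳 × 𝒴 → ℝ := fun z =>
    Real.logb 2 (1 / (sideGivenX P κ Δ z.1).real {side P κ Δ z})
  let lam : 𝒳 × 𝒴 → ℝ := fun z => if IsSingular P κ then 0 else
    Real.logb 2 (1 / (gamLaw P κ Δ).real {gam P κ Δ z})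
  have hMk : IsMarkovKernel (sideGivenX P κ Δ) := by unfold sideGivenX; infer_instance
  have hι0 : ∀ z, 0 ≤ ι z := fun z => logb_one_div_measureReal_nonneg _ _
  have hlam0 : ∀ z, 0 ≤ lam z := fun z => by
    simp only [lam]; split_ifs
    exacts [le_rfl, logb_one_div_measureReal_nonneg _ _]
  have hgraph : Measurable fun z : 𝒳 × 𝒴 => (z.1, side P κ Δ z) :=
    measurable_fst.prodMk (measurable_side P κ Δ)
  have hιm : Measurable ι := by
    have h := (measurable_conditional_selfInfo (P := P) (κ := κ) (Δ := Δ)).comp hgraph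
    exact h
  have hlamm : Measurable lam := by
    have h := (measurable_of_countable fun g : ℤ => if IsSingular P κ then (0 : ℝ) else
      Real.logb 2 (1 / (gamLaw P κ Δ).real {g})).comp (measurable_gam P κ Δ)
    exact h
  have hlamH : ∫⁻ z, ENNReal.ofReal (lam z) ∂(P ⊗ₘ κ) =
      if IsSingular P κ then 0 else entropy (gamLaw P κ Δ) := by
    simp only [lam]
    split_ifs
    · simp
    · exact lintegral_selfInfo_gam
  have hle' : ∀ᵐ z ∂(P ⊗ₘ κ), 0 ≤ indexBound (tauAux Δ (side P κ Δ z)) +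
        indexBound (tauPrimary P κ Δ (side P κ Δ z) (gam P κ Δ z)) ∧
      indexBound (tauAux Δ (side P κ Δ z)) +
        indexBound (tauPrimary P κ Δ (side P κ Δ z) (gam P κ Δ z)) ≤ f z + (lam z + ι z) := by
    filter_upwards [ae_one_le_tau hΔ hac, ae_mul_gamBarBar_le hΔ hac] with z h1 h2
    constructor
    · have h3 : 0 ≤ Real.logb 2 (tauAux Δ (side P κ Δ z)) :=
        Real.logb_nonneg (by norm_num) h1.1
      have h4 : 0 ≤ Real.logb 2 (tauPrimary P κ Δ (side P κ Δ z) (gam P κ Δ z)) :=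
        Real.logb_nonneg (by norm_num) h1.2
      unfold indexBound
      linarith
    · rw [indexBound_add_indexBound]
      have h3 : Δ * (gam P κ Δ z : ℝ) ≤ Real.logb 2 (density P κ z).toReal := mul_cell_le hΔ _
      have h4 : (if IsSingular P κ then 0 else Δ * ((side P κ Δ z).2.1 : ℝ)) ≤ lam z := by
        simp only [lam]
        split_ifs
        · exact le_rfl
        · exact mul_cell_le hΔ _
      simp only [f, ι]
      linarith
  refine (lintegral_length_le hΔ hac C).trans ?_
  have hmain : ∫⁻ z, ENNReal.ofReal (indexBound (tauAux Δ (side P κ Δ z)) +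
        indexBound (tauPrimary P κ Δ (side P κ Δ z) (gam P κ Δ z))) ∂(P ⊗ₘ κ) ≤
      (mutualInfo P κ + ENNReal.ofReal c) +
        ((if IsSingular P κ then 0 else entropy (gamLaw P κ Δ)) + entropy (sideLaw P κ Δ)) := by
    calc _ ≤ ∫⁻ z, ENNReal.ofReal (f z + (lam z + ι z)) ∂(P ⊗ₘ κ) := by
          refine lintegral_mono_ae ?_
          filter_upwards [hle'] with z hz
          exact ENNReal.ofReal_le_ofReal hz.2
      _ ≤ ENNReal.ofReal (∫ z, f z ∂(P ⊗ₘ κ)) +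
          ∫⁻ z, ENNReal.ofReal (lam z + ι z) ∂(P ⊗ₘ κ) := by
          refine lintegral_ofReal_add_le (hint.add (integrable_const c)) (hlamm.add hιm)
            (fun z => add_nonneg (hlam0 z) (hι0 z)) ?_
          filter_upwards [hle'] with z hz
          exact hz.1.trans hz.2
      _ ≤ _ := by
          refine add_le_add ?_ ?_
          · simp only [f]
            rw [integral_add hint (integrable_const c), ← hmi]
            refine ENNReal.ofReal_add_le.trans ?_
            simp
          · simp only [fun z => ENNReal.ofReal_add (hlam0 z) (hι0 z)]
            rw [lintegral_add_left hlamm.ennreal_ofReal, hlamH]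
            gcongr
            exact lintegral_conditional_selfInfo_le
  have hconst : 1 + ENNReal.ofReal c ≤
      ENNReal.ofReal (7 * Δ + 3 + 2 * Real.logb 2 (Real.exp 1)) := by
    rw [← ENNReal.ofReal_one, ← ENNReal.ofReal_add zero_le_one hc0]
    refine ENNReal.ofReal_le_ofReal ?_
    rw [hc]
    linarith
  calc _ ≤ (entropy (sideLaw P κ Δ) + 1) + ((mutualInfo P κ + ENNReal.ofReal c) +
        ((if IsSingular P κ then 0 else entropy (gamLaw P κ Δ)) + entropy (sideLaw P κ Δ))) :=
        add_le_add le_rfl hmain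
    _ = mutualInfo P κ + (if IsSingular P κ then 0 else entropy (gamLaw P κ Δ)) +
        (2 * entropy (sideLaw P κ Δ) + (1 + ENNReal.ofReal c)) := by ring
    _ ≤ _ := by
        unfold errorTerm
        gcongr

end Scheme

/-! ### Mutual information of a memoryless channel -/

section Block

/-- The relative entropy of product laws is at most additive: the chain rule, and the invariance of
relative entropy under the exchange of the two factors. -/
lemma klDiv_prod_le {α β : Type*} [MeasurableSpace α] [MeasurableSpace β] (μ₁ ν₁ : Measure α)
    (μ₂ ν₂ : Measure β) [IsProbabilityMeasure μ₁] [IsProbabilityMeasure ν₁]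
    [IsProbabilityMeasure μ₂] [IsProbabilityMeasure ν₂] :
    InformationTheory.klDiv (μ₁.prod μ₂) (ν₁.prod ν₂) ≤
      InformationTheory.klDiv μ₁ ν₁ + InformationTheory.klDiv μ₂ ν₂ := by
  rw [← Measure.compProd_const, ← Measure.compProd_const,
    InformationTheory.klDiv_compProd_eq_add]
  gcongr
  rw [Measure.compProd_const, Measure.compProd_const, ← Measure.prod_swap (μ := μ₂),
    ← Measure.prod_swap (μ := ν₂)]
  refine (InformationTheory.klDiv_map_le _ _ measurable_swap).trans (le_of_eq ?_)
  rw [← Measure.compProd_const, ← Measure.compProd_const, InformationTheory.klDiv_compProd_left]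

/-- The relative entropy of `n`-fold product laws is at most `n` times that of the factors. -/
lemma klDiv_pi_le {α : Type*} [MeasurableSpace α] (μ ν : Measure α) [IsProbabilityMeasure μ]
    [IsProbabilityMeasure ν] (n : ℕ) :
    InformationTheory.klDiv (Measure.pi fun _ : Fin n => μ) (Measure.pi fun _ : Fin n => ν) ≤
      n * InformationTheory.klDiv μ ν := by
  induction n with
  | zero =>
    rw [Measure.pi_of_empty, Measure.pi_of_empty, InformationTheory.klDiv_self]
    exact zero_le
  | succ n ih =>
    have e : ∀ ρ : Measure α, IsProbabilityMeasure ρ → (Measure.pi fun _ : Fin (n + 1) => ρ) =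
        (ρ.prod (Measure.pi fun _ : Fin n => ρ)).map
          (MeasurableEquiv.piFinSuccAbove (fun _ : Fin (n + 1) => α) 0).symm := fun ρ _ =>
      ((measurePreserving_piFinSuccAbove (fun _ : Fin (n + 1) => ρ) 0).symm _).map_eq.symm
    rw [e μ inferInstance, e ν inferInstance]
    refine (InformationTheory.klDiv_map_le _ _ (MeasurableEquiv.measurable _)).trans ?_
    refine (klDiv_prod_le _ _ _ _).trans ?_
    push_cast
    rw [add_mul, one_mul, add_comm]
    gcongr

variable {𝒳 𝒴 : Type*} [MeasurableSpace 𝒳] [MeasurableSpace 𝒴]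
  (P : Measure 𝒳) [IsProbabilityMeasure P]

/-- The expectation of a product of functions of independent letters factorizes. -/
lemma lintegral_blockSource_prod {n : ℕ} {f : Fin n → 𝒳 → ℝ≥0∞} (hf : ∀ i, Measurable (f i)) :
    ∫⁻ x, ∏ i, f i (x i) ∂(blockSource P n) = ∏ i, ∫⁻ x, f i x ∂P := by
  have hind : iIndepFun (fun i (x : Fin n → 𝒳) => f i (x i)) (blockSource P n) :=
    iIndepFun_pi fun i => (hf i).aemeasurable
  rw [lintegral_prod_eq_prod_lintegral_of_indepFun _ _ hind
    fun i => (hf i).comp (measurable_pi_apply i)]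
  refine Finset.prod_congr rfl fun i _ => ?_
  exact (measurePreserving_eval (fun _ : Fin n => P) i).lintegral_comp (hf i)

variable (κ : Kernel 𝒳 𝒴) [IsMarkovKernel κ]

/-- The pairs `(Xᵢ, Yᵢ)` are i.i.d. with the one-letter joint law. -/
lemma pi_compProd (n : ℕ) : (Measure.pi fun _ : Fin n => P ⊗ₘ κ) =
    (blockSource P n ⊗ₘ blockChannel κ n).map
      (MeasurableEquiv.arrowProdEquivProdArrow 𝒳 𝒴 (Fin n)).symm := by
  refine Measure.pi_eq fun s hs => ?_
  rw [MeasurableEquiv.map_apply, Measure.compProd_apply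
    (MeasurableEquiv.measurable _ (MeasurableSet.univ_pi hs))]
  have hsec : ∀ x : Fin n → 𝒳, blockChannel κ n x (Prod.mk x ⁻¹'
      ((MeasurableEquiv.arrowProdEquivProdArrow 𝒳 𝒴 (Fin n)).symm ⁻¹' Set.univ.pi s)) =
      ∏ i, κ (x i) (Prod.mk (x i) ⁻¹' s i) := by
    intro x
    have h := Measure.pi_pi (fun i => κ (x i)) fun i => Prod.mk (x i) ⁻¹' s i
    exact h
  simp only [hsec]
  rw [lintegral_blockSource_prod P (f := fun i x => κ x (Prod.mk x ⁻¹' s i))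
    fun i => Kernel.measurable_kernel_prodMk_left (hs i)]
  exact Finset.prod_congr rfl fun i _ => (Measure.compProd_apply (hs i)).symm

/-- The outputs are i.i.d. with the one-letter output law. -/
lemma blockChannel_comp_blockSource (n : ℕ) :
    blockChannel κ n ∘ₘ blockSource P n = Measure.pi fun _ : Fin n => κ ∘ₘ P := by
  refine (Measure.pi_eq fun s hs => ?_).symm
  rw [Measure.bind_apply (MeasurableSet.univ_pi hs) (Kernel.aemeasurable _)]
  have hsec : ∀ x : Fin n → 𝒳, blockChannel κ n x (Set.univ.pi s) = ∏ i, κ (x i) (s i) :=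
    fun x => Measure.pi_pi (fun i => κ (x i)) s
  simp only [hsec]
  rw [lintegral_blockSource_prod P (f := fun i x => κ x (s i)) fun i => κ.measurable_coe (hs i)]
  exact Finset.prod_congr rfl fun i _ =>
    (Measure.bind_apply (hs i) (Kernel.aemeasurable _)).symm

/-- The mutual information of `n` uses of a memoryless channel with i.i.d. inputs is at most `n`
times the one-letter mutual information. -/
lemma mutualInfo_block_le (n : ℕ) :
    mutualInfo (blockSource P n) (blockChannel κ n) ≤ n * mutualInfo P κ := by
  unfold mutualInfo
  rw [← mul_div_assoc]
  refine ENNReal.div_le_div_right ?_ _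
  have h1 : blockSource P n ⊗ₘ blockChannel κ n = (Measure.pi fun _ : Fin n => P ⊗ₘ κ).map
      (MeasurableEquiv.arrowProdEquivProdArrow 𝒳 𝒴 (Fin n)) := by
    rw [pi_compProd, MeasurableEquiv.map_map_symm]
  have h2 : (blockSource P n).prod (blockChannel κ n ∘ₘ blockSource P n) =
      (Measure.pi fun _ : Fin n => P.prod (κ ∘ₘ P)).map
        (MeasurableEquiv.arrowProdEquivProdArrow 𝒳 𝒴 (Fin n)) := by
    rw [blockChannel_comp_blockSource]
    exact (measurePreserving_arrowProdEquivProdArrow 𝒳 𝒴 (Fin n) (fun _ => P)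
      fun _ => κ ∘ₘ P).map_eq.symm
  rw [h1, h2]
  exact (InformationTheory.klDiv_map_le _ _ (MeasurableEquiv.measurable _)).trans
    (klDiv_pi_le _ _ n)

end Block

/-- Division of a block bound by the block length. -/
lemma mul_add_div_le {n : ℕ} (hn : 0 < n) {L I H E : ℝ≥0∞} (h : L ≤ n * I + H + E) :
    L / n ≤ I + H / n + E / n := by
  have hn0 : (n : ℝ≥0∞) ≠ 0 := by exact_mod_cast hn.ne'
  refine (ENNReal.div_le_div_right h _).trans (le_of_eq ?_)
  rw [ENNReal.add_div, ENNReal.add_div, mul_comm,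
    ENNReal.mul_div_cancel_right hn0 (ENNReal.natCast_ne_top n)]

end ChannelSynthesis

end

theorem mainTheorem3 {𝒳 𝒴 : Type*}
    [TopologicalSpace 𝒳] [PolishSpace 𝒳] [MeasurableSpace 𝒳] [BorelSpace 𝒳]
    [TopologicalSpace 𝒴] [PolishSpace 𝒴] [MeasurableSpace 𝒴] [BorelSpace 𝒴] [Nonempty 𝒴]
    (P : Measure 𝒳) [IsProbabilityMeasure P] (κ : Kernel 𝒳 𝒴) [IsMarkovKernel κ]
    (hI : mutualInfo P κ ≠ ⊤) (n : ℕ) (hn : 0 < n) (Δ : ℝ) (hΔ : 0 < Δ)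
    (C : EntropyCodes (blockSource P n) (blockChannel κ n) Δ) :
    (scheme (blockSource P n) (blockChannel κ n) Δ C).Simulates
        (blockSource P n) (blockChannel κ n) ∧
    (IsSingular (blockSource P n) (blockChannel κ n) →
      (scheme (blockSource P n) (blockChannel κ n) Δ C).rate n (blockSource P n) ≤
        mutualInfo P κ + errorTerm (blockSource P n) (blockChannel κ n) Δ / n) ∧
    (¬ IsSingular (blockSource P n) (blockChannel κ n) →
      (scheme (blockSource P n) (blockChannel κ n) Δ C).rate n (blockSource P n) ≤
        mutualInfo P κ + entropy (gamLaw (blockSource P n) (blockChannel κ n) Δ) / n +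
          errorTerm (blockSource P n) (blockChannel κ n) Δ / n) := by
  have hle := mutualInfo_block_le P κ n
  have hI' : mutualInfo (blockSource P n) (blockChannel κ n) ≠ ⊤ :=
    ne_top_of_le_ne_top (ENNReal.mul_ne_top (ENNReal.natCast_ne_top n) hI) hle
  have hlen := lintegral_length_le_mutualInfo hΔ hI' C
  refine ⟨scheme_simulates hΔ (integral_logb_density hI').1 C, fun hs => ?_, fun hs => ?_⟩
  · rw [if_pos hs] at hlen
    have h := mul_add_div_le hn (hlen.trans (by gcongr))
    rw [ENNReal.zero_div, add_zero] at h
    exact h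
  · rw [if_neg hs] at hlen
    exact mul_add_div_le hn (hlen.trans (by gcongr))
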